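/- Let $u_0<1/2$ and let $b:(u_0,\infty)\to(0,\infty)$ be a Borel function, bounded on $[1/2,R]$ for every $R$, that is slowly varying in the sense of Zygmund: for every $\delta>0$, $u^{\delta}b(u)$ is non-decreasing and $u^{-\delta}b(u)$ is non-increasing for $u$ large enough. Put $$\gamma_n=\frac{c}{n}\sum_{k\ge n}\frac{1}{\sqrt{k^3b(k)}}\quad(n\ge 1),$$ where $c>0$ is chosen so that $\sum_{n\ge1}\gamma_n=1$, let $B(z)=\sum_{n\ge1}\gamma_nz^n$ for $|z|\le 1$, and let $\{\alpha_n\}_{n\ge0}$ be the Taylor coefficients at $0$ of $A=1/(1-B)$, so that $A(z)=\sum_{n\ge0}\alpha_nz^n$ for $|z|<1$. Let $T$ be a normal contraction or a (not necessarily surjective) linear isometry of a complex Hilbert space $\mathcal H$, let $f\in\mathcal H$, and write $U_n f=\sum_{k=1}^nT^kf$. There is exactly one finite positive Borel measure $\mu_f$ on the closed unit disk $\overline D$ (the spectral measure of $f$) such that $$\Big\|\sum_{k=0}^na_kT^kf\Big\|^2=\int_{\overline D}\Big|\sum_{k=0}^na_kz^k\Big|^2\,\mu_f(dz)\qquad\text{for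 all } n\ge 0 \text{ and } (a_0,\dots,a_n)\in\mathbb C^{n+1},$$ and the following are equivalent: (i) the series $\sum_{n\ge0}\alpha_nT^nf$ converges in norm (that is, its partial sums converge in $\mathcal H$); (ii) $\displaystyle\int_{\overline D}\frac{b\big(\frac1{|1-z|}\big)}{|1-z|}\,\mu_f(dz)<+\infty$, where the integrand is given the value $+\infty$ at $z=1$; (iii) $\displaystyle\sum_{n\ge1}\frac{b(n)\|U_n f\|^2}{n^2}<+\infty$. -/

import Mathlib

open MeasureTheory Filter Topology
open scoped ENNReal

namespace SpectralSeries

/-- `b : (u₀, ∞) → (0, ∞)` is slowly varying (in the sense of Zygmund): for every `δ > 0`,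
`u ^ δ * b u` is non-decreasing and `u ^ (-δ) * b u` is non-increasing for `u` large enough.
The values of `b` outside `(u₀, ∞)` play no role. -/
structure IsSlowlyVarying (u₀ : ℝ) (b : ℝ → ℝ) : Prop where
  pos : ∀ u, u₀ < u → 0 < b u
  eventually_monotone : ∀ δ : ℝ, 0 < δ → ∃ v : ℝ, MonotoneOn (fun u : ℝ => u ^ δ * b u) (Set.Ici v)
  eventually_antitone :
    ∀ δ : ℝ, 0 < δ → ∃ v : ℝ, AntitoneOn (fun u : ℝ => u ^ (-δ) * b u) (Set.Ici v)

/-- `(1 / n) * ∑_{k ≥ n} 1 / √(k³ b(k))`, used for `n ≥ 1`: the weight before normalization. -/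
noncomputable def rawWeight (b : ℝ → ℝ) (n : ℕ) : ℝ :=
  1 / (n : ℝ) * ∑' j : ℕ, 1 / Real.sqrt (((n + j : ℕ) : ℝ) ^ 3 * b ((n + j : ℕ) : ℝ))

/-- The normalizing constant `c`, for which the weights `γ_n`, `n ≥ 1`, have sum `1`. -/
noncomputable def normConst (b : ℝ → ℝ) : ℝ := (∑' n : ℕ, rawWeight b (n + 1))⁻¹

/-- `γ_n = (c / n) * ∑_{k ≥ n} 1 / √(k³ b(k))`, used for `n ≥ 1`. -/
noncomputable def gammaCoeff (b : ℝ → ℝ) (n : ℕ) : ℝ := normConst b * rawWeight b n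

/-- `B(z) = ∑_{n ≥ 1} γ_n z ^ n`. -/
noncomputable def seriesB (b : ℝ → ℝ) (z : ℂ) : ℂ :=
  ∑' n : ℕ, (gammaCoeff b (n + 1) : ℂ) * z ^ (n + 1)

/-- `A = 1 / (1 - B)`. -/
noncomputable def funA (b : ℝ → ℝ) (z : ℂ) : ℂ := 1 / (1 - seriesB b z)

/-- `α_n`, the `n`-th Taylor coefficient at `0` of the function `A`, which is analytic on the open
unit disk; thus `A(z) = ∑_{n ≥ 0} α_n z ^ n` there. -/
noncomputable def alphaCoeff (b : ℝ → ℝ) (n : ℕ) : ℂ :=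
  iteratedDeriv n (funA b) 0 / (n.factorial : ℂ)

section Operator

variable {H : Type*} [NormedAddCommGroup H] [InnerProductSpace ℂ H]

/-- `U_n f = ∑_{k = 1}^n T ^ k f`. -/
noncomputable def powerSum (T : H →L[ℂ] H) (n : ℕ) (f : H) : H :=
  ∑ k ∈ Finset.Icc 1 n, (T ^ k) f

/-- `μ` is the spectral measure of `f` with respect to `T`: a finite positive Borel measure on the
closed unit disk (seen as a measure on `ℂ` that vanishes off the disk) with
`‖∑ a_k T ^ k f‖ ^ 2 = ∫ |∑ a_k z ^ k| ^ 2 dμ` for all complex `a_0, …, a_n`. -/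
structure IsSpectralMeasure (T : H →L[ℂ] H) (f : H) (μ : Measure ℂ) : Prop where
  finite : IsFiniteMeasure μ
  compl_disk : μ (Metric.closedBall (0 : ℂ) 1)ᶜ = 0
  norm_sq : ∀ (n : ℕ) (a : ℕ → ℂ),
    ‖∑ k ∈ Finset.range (n + 1), a k • (T ^ k) f‖ ^ 2 =
      ∫ z in Metric.closedBall (0 : ℂ) 1, ‖∑ k ∈ Finset.range (n + 1), a k * z ^ k‖ ^ 2 ∂μ

end Operator

/-- The function `b(1 / |1 - z|) / |1 - z|`, with the value `+∞` at `z = 1`. -/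
noncomputable def diskWeight (b : ℝ → ℝ) (z : ℂ) : ℝ≥0∞ :=
  if z = 1 then ⊤ else ENNReal.ofReal (b (1 / ‖1 - z‖) / ‖1 - z‖)

end SpectralSeries

/-!
Write `u = 1 / |1 - z|`. The spectral measure turns the three conditions into integrals over the
closed disk, and each of the integrands turns out to be comparable with `u * b(u)` near `z = 1`.

*Spectral measure.* The defining identity amounts, by polarization, to prescribing the moments
`∫ conj(z ^ n) z ^ m dμ = ⟪T ^ n f, T ^ m f⟫`. Uniqueness is the Stone–Weierstrass theorem
(`IsSpectralMeasure.unique`). Existence comes from the continuous functional calculus and the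
Riesz–Markov–Kakutani theorem for a normal contraction, and from a weak limit of Fejér means on the
circle for an isometry.

*The function `A`.* The Taylor coefficients of `A = 1 / (1 - B)` form the renewal sequence `a` of the
weights `γ` (`HalfRegular.alphaCoeff_eq`). Multiplying a partial sum `S_N` of `∑ a_n z ^ n` by `1 - B`
gives `1 - z ^ N R_N(z)`, where `R_N` has nonnegative coefficients of sum `1`: they are the
distribution of the overshoot of the renewal process over the level `N - 1`. Hence
`|S_N| ≤ 2 |A|` on the disk, for every `N`. As the weights decrease, so do the coefficients of `R_N`,
the first of which is `a_N`; so `|R_N(z)| ≤ 2 a_N / |1 - z|`, and `a_N → 0` because the weights have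
infinite mean. Therefore `S_N → A` pointwise off `1`, dominated by `2 |A|`, while `S_N(1) → ∞`. Fatou's
lemma and dominated convergence then show that `∑ α_n T ^ n f` converges exactly when `|A|²`, given
the value `+∞` at `1`, is integrable.

*Comparisons.* Karamata's estimates `tail_le_of_antitoneOn` and `sum_Ico_le_of_monotoneOn` evaluate
sums of regularly varying terms. The upper bound for `|1 - B|` follows from
`|1 - z ^ n| ≤ min (n / u) 2`. For the lower bound, `Re (1 - B) = ∑ γ_n (1 - Re z ^ n)` has nonnegative
terms and decreasing weights, so that it is at least `γ_N * (N - |z + ⋯ + z ^ N|) ≥ γ_N * N / 2` for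
`N ≥ 4 u`. Together they give `|A|² ≍ u * b(u)`. The same estimates, with
`|z + ⋯ + z ^ n| ≤ min n (2 u)` and `|z + ⋯ + z ^ n| ≥ n / 2` for `n ≤ u / 2`, give
`∑ b(n) |z + ⋯ + z ^ n|² / n² ≍ u * b(u)`, and Tonelli's theorem identifies the integral of the left
side with the weighted series of `‖U_n f‖²`.
-/

namespace SpectralSeries

/-! ### Karamata-type estimates for sums of regularly varying functions -/

/-- The mean value inequality behind the comparison of `∑ k ^ (-q)` with a telescoping sum. -/
lemma mul_rpow_sub_one_le_rpow_sub_rpow {x s : ℝ} (hx : 1 ≤ x) (hs : 0 ≤ s) (hs1 : s ≤ 1) :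
    s * x ^ (s - 1) ≤ x ^ s - (x - 1) ^ s := by
  have hx0 : 0 < x := by linarith
  have hinv : x⁻¹ ≤ 1 := inv_le_one_of_one_le₀ hx
  have h1 : (1 + -x⁻¹) ^ s ≤ 1 + s * (-x⁻¹) :=
    rpow_one_add_le_one_add_mul_self (by linarith) hs hs1
  have h2 : (x - 1) ^ s = x ^ s * (1 + -x⁻¹) ^ s := by
    rw [← Real.mul_rpow hx0.le (by linarith)]
    congr 1
    field_simp
    ring
  have h3 : x ^ (s - 1) = x ^ s * x⁻¹ := by
    rw [Real.rpow_sub_one hx0.ne']; rfl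
  rw [h2, h3]
  nlinarith [mul_le_mul_of_nonneg_left h1 (Real.rpow_nonneg hx0.le s)]

lemma sum_Ico_rpow_neg_le {q : ℝ} (hq0 : 0 ≤ q) (hq1 : q < 1) (N : ℕ) :
    ∑ k ∈ Finset.Ico 1 (N + 1), (k : ℝ) ^ (-q) ≤ (N : ℝ) ^ (1 - q) / (1 - q) := by
  have hs : 0 < 1 - q := by linarith
  induction N with
  | zero => simp [Real.zero_rpow hs.ne']
  | succ n ih =>
    rw [Finset.sum_Ico_succ_top (by omega)]
    have h := mul_rpow_sub_one_le_rpow_sub_rpow (x := ((n + 1 : ℕ) : ℝ)) (s := 1 - q)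
      (by push_cast; linarith [n.cast_nonneg (α := ℝ)]) hs.le (by linarith)
    have e1 : (1 - q - 1 : ℝ) = -q := by ring
    have e2 : (((n + 1 : ℕ) : ℝ) - 1) = n := by push_cast; ring
    rw [e1, e2] at h
    have h' : ((n + 1 : ℕ) : ℝ) ^ (-q) ≤
        ((n + 1 : ℕ) : ℝ) ^ (1 - q) / (1 - q) - (n : ℝ) ^ (1 - q) / (1 - q) := by
      rw [← sub_div, le_div_iff₀ hs]; linarith
    linarith

lemma rpow_neg_le_telescope {p x : ℝ} (hp : 1 < p) (hp2 : p ≤ 2) (hx : 1 ≤ x) :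
    x ^ (-p) ≤ 2 / (p - 1) * (x ^ (1 - p) - (x + 1) ^ (1 - p)) := by
  have hx0 : 0 < x := by linarith
  have hs : 0 < p - 1 := by linarith
  have hinv : (x + 1)⁻¹ ≤ 1 := inv_le_one_of_one_le₀ (by linarith)
  have h1 : (1 + -(x + 1)⁻¹) ^ (p - 1) ≤ 1 + (p - 1) * (-(x + 1)⁻¹) :=
    rpow_one_add_le_one_add_mul_self (by linarith) hs.le (by linarith)
  have h2 : (x + 1) ^ (1 - p) = x ^ (1 - p) * (1 + -(x + 1)⁻¹) ^ (p - 1) := by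
    have e : 1 + -(x + 1)⁻¹ = x / (x + 1) := by field_simp; ring
    have e1 : (1 - p) = -(p - 1) := by ring
    rw [e, Real.div_rpow hx0.le (by linarith), e1, Real.rpow_neg hx0.le,
      Real.rpow_neg (by linarith)]
    have := Real.rpow_pos_of_pos hx0 (p - 1)
    field_simp
  have h3 : x ^ (-p) = x ^ (1 - p) * x⁻¹ := by
    have e1 : -p = (1 - p) - 1 := by ring
    rw [e1, Real.rpow_sub_one hx0.ne']; rfl
  have hpos := Real.rpow_pos_of_pos hx0 (1 - p)
  have h4 : x⁻¹ ≤ 2 * (x + 1)⁻¹ := by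
    rw [← div_eq_mul_inv, inv_eq_one_div, div_le_div_iff₀ hx0 (by linarith)]; linarith
  rw [h2, h3]
  have h5 : x ^ (1 - p) * x⁻¹ ≤ x ^ (1 - p) * (2 * (x + 1)⁻¹) :=
    mul_le_mul_of_nonneg_left h4 hpos.le
  have h6 : x ^ (1 - p) * ((p - 1) * (x + 1)⁻¹) ≤
      x ^ (1 - p) - x ^ (1 - p) * (1 + -(x + 1)⁻¹) ^ (p - 1) := by
    nlinarith [mul_le_mul_of_nonneg_left h1 hpos.le]
  calc x ^ (1 - p) * x⁻¹ ≤ x ^ (1 - p) * (2 * (x + 1)⁻¹) := h5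
    _ = 2 / (p - 1) * (x ^ (1 - p) * ((p - 1) * (x + 1)⁻¹)) := by field_simp
    _ ≤ _ := mul_le_mul_of_nonneg_left h6 (by positivity)

lemma sum_range_rpow_neg_le {p : ℝ} (hp : 1 < p) (hp2 : p ≤ 2) {x : ℝ} (hx : 1 ≤ x) (m : ℕ) :
    ∑ j ∈ Finset.range m, (x + j) ^ (-p) ≤ 2 / (p - 1) * x ^ (1 - p) := by
  have key : ∑ j ∈ Finset.range m, (x + j) ^ (-p) ≤
      2 / (p - 1) * (x ^ (1 - p) - (x + m) ^ (1 - p)) := by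
    induction m with
    | zero => simp
    | succ n ih =>
      rw [Finset.sum_range_succ]
      have h := rpow_neg_le_telescope hp hp2 (x := x + n)
        (by linarith [n.cast_nonneg (α := ℝ)])
      push_cast
      rw [← add_assoc]
      linarith
  refine key.trans (mul_le_mul_of_nonneg_left ?_ (by
    have : 0 < p - 1 := by linarith
    positivity))
  have : 0 ≤ (x + m) ^ (1 - p) := Real.rpow_nonneg (by positivity) _
  linarith

/-- Karamata's estimate for tails: if `u ^ p * g u` is eventually non-increasing for some `p > 1`,
then `∑_{k ≥ u} g k` is `O(u * g u)`. -/
lemma tail_le_of_antitoneOn {g : ℝ → ℝ} {V p : ℝ} (hV : 1 ≤ V) (hp : 1 < p) (hp2 : p ≤ 2)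
    (hg : ∀ u, V ≤ u → 0 ≤ g u) (hanti : AntitoneOn (fun u => u ^ p * g u) (Set.Ici V))
    {u : ℝ} (hu : V ≤ u) {N : ℕ} (huN : u ≤ N) :
    Summable (fun j : ℕ => g ((N + j : ℕ) : ℝ)) ∧
      ∑' j : ℕ, g ((N + j : ℕ) : ℝ) ≤ 2 / (p - 1) * (u * g u) := by
  have hu0 : 0 < u := by linarith
  have hterm : ∀ j : ℕ, g ((N + j : ℕ) : ℝ) ≤ (u ^ p * g u) * (u + j) ^ (-p) := by
    intro j
    have hle : u + j ≤ ((N + j : ℕ) : ℝ) := by push_cast; linarith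
    have hj : 0 ≤ (j : ℝ) := j.cast_nonneg
    have hpos : 0 < ((N + j : ℕ) : ℝ) := by linarith
    have h := hanti (Set.mem_Ici.2 hu) (Set.mem_Ici.2 (show V ≤ ((N + j : ℕ) : ℝ) by linarith))
      (by linarith)
    simp only at h
    have h1 : g ((N + j : ℕ) : ℝ) ≤ (u ^ p * g u) * ((N + j : ℕ) : ℝ) ^ (-p) := by
      rw [Real.rpow_neg hpos.le, ← div_eq_mul_inv, le_div_iff₀ (Real.rpow_pos_of_pos hpos p)]
      linarith
    refine h1.trans (mul_le_mul_of_nonneg_left ?_ (mul_nonneg (Real.rpow_nonneg hu0.le _) (hg u hu)))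
    exact Real.rpow_le_rpow_of_nonpos (by linarith) hle (by linarith)
  have hnn : ∀ j : ℕ, 0 ≤ g ((N + j : ℕ) : ℝ) := fun j => hg _ (by
    push_cast; linarith [j.cast_nonneg (α := ℝ)])
  have hbound : ∀ m : ℕ, ∑ j ∈ Finset.range m, g ((N + j : ℕ) : ℝ) ≤
      2 / (p - 1) * (u * g u) := by
    intro m
    calc _ ≤ ∑ j ∈ Finset.range m, (u ^ p * g u) * (u + j) ^ (-p) :=
          Finset.sum_le_sum fun j _ => hterm j
      _ = (u ^ p * g u) * ∑ j ∈ Finset.range m, (u + j) ^ (-p) := by rw [Finset.mul_sum]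
      _ ≤ (u ^ p * g u) * (2 / (p - 1) * u ^ (1 - p)) :=
          mul_le_mul_of_nonneg_left (sum_range_rpow_neg_le hp hp2 (hV.trans hu) m)
            (mul_nonneg (Real.rpow_nonneg hu0.le _) (hg u hu))
      _ = 2 / (p - 1) * ((u ^ p * u ^ (1 - p)) * g u) := by ring
      _ = _ := by rw [← Real.rpow_add hu0]; simp
  exact ⟨summable_of_sum_range_le hnn hbound, Real.tsum_le_of_sum_range_le hnn hbound⟩

/-- Karamata's estimate for initial sums: if `u ^ q * g u` is eventually non-decreasing for some
`q < 1`, then `∑_{k ≤ u} g k`, started far enough, is `O(u * g u)`. -/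
lemma sum_Ico_le_of_monotoneOn {g : ℝ → ℝ} {V q : ℝ} (hV : 1 ≤ V) (hq0 : 0 ≤ q) (hq1 : q < 1)
    (hg : ∀ u, V ≤ u → 0 ≤ g u) (hmono : MonotoneOn (fun u => u ^ q * g u) (Set.Ici V))
    {u : ℝ} (hu : V ≤ u) {M N : ℕ} (hM : V ≤ M) (huN : (N : ℝ) ≤ u + 1) :
    ∑ k ∈ Finset.Ico M N, g k ≤ 1 / (1 - q) * (u * g u) := by
  have hu0 : 0 < u := by linarith
  have hM1 : 1 ≤ M := by exact_mod_cast hV.trans hM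
  have hq : 0 < 1 - q := by linarith
  have hc : 0 ≤ u ^ q * g u := mul_nonneg (Real.rpow_nonneg hu0.le _) (hg u hu)
  have hterm : ∀ k ∈ Finset.Ico M N, g k ≤ (u ^ q * g u) * (k : ℝ) ^ (-q) := by
    intro k hk
    rw [Finset.mem_Ico] at hk
    have hk1 : V ≤ k := hM.trans (by exact_mod_cast hk.1)
    have hk0 : (0 : ℝ) < k := by linarith
    have hku : (k : ℝ) ≤ u := by
      have : ((k + 1 : ℕ) : ℝ) ≤ N := by exact_mod_cast hk.2
      push_cast at this; linarith
    have h := hmono (Set.mem_Ici.2 hk1) (Set.mem_Ici.2 hu) hku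
    simp only at h
    rw [Real.rpow_neg hk0.le, ← div_eq_mul_inv, le_div_iff₀ (Real.rpow_pos_of_pos hk0 q)]
    linarith
  rcases Nat.eq_zero_or_pos N with rfl | hN
  · rw [Finset.Ico_eq_empty (by omega), Finset.sum_empty]
    exact mul_nonneg (by positivity) (mul_nonneg hu0.le (hg u hu))
  obtain ⟨n, rfl⟩ : ∃ n, N = n + 1 := ⟨N - 1, by omega⟩
  have hnu : (n : ℝ) ≤ u := by push_cast at huN; linarith
  calc _ ≤ ∑ k ∈ Finset.Ico M (n + 1), (u ^ q * g u) * (k : ℝ) ^ (-q) :=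
        Finset.sum_le_sum hterm
    _ ≤ ∑ k ∈ Finset.Ico 1 (n + 1), (u ^ q * g u) * (k : ℝ) ^ (-q) :=
        Finset.sum_le_sum_of_subset_of_nonneg (Finset.Ico_subset_Ico_left hM1)
          fun k _ _ => mul_nonneg hc (Real.rpow_nonneg k.cast_nonneg _)
    _ = (u ^ q * g u) * ∑ k ∈ Finset.Ico 1 (n + 1), (k : ℝ) ^ (-q) := by rw [Finset.mul_sum]
    _ ≤ (u ^ q * g u) * ((n : ℝ) ^ (1 - q) / (1 - q)) :=
        mul_le_mul_of_nonneg_left (sum_Ico_rpow_neg_le hq0 hq1 n) hc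
    _ ≤ (u ^ q * g u) * (u ^ (1 - q) / (1 - q)) := by
        gcongr
    _ = 1 / (1 - q) * ((u ^ q * u ^ (1 - q)) * g u) := by ring
    _ = _ := by rw [← Real.rpow_add hu0]; simp

/-- `1 / √(u³ b(u))`, the summand in the definition of the weights `γ_n`. -/
noncomputable def tailTerm (b : ℝ → ℝ) (u : ℝ) : ℝ := 1 / Real.sqrt (u ^ 3 * b u)

/-- `τ_n = ∑_{k ≥ n} 1 / √(k³ b(k))`, so that `n * γ_n = c * τ_n`. -/
noncomputable def tailSum (b : ℝ → ℝ) (n : ℕ) : ℝ := ∑' j : ℕ, tailTerm b ((n + j : ℕ) : ℝ)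

lemma rawWeight_eq (b : ℝ → ℝ) (n : ℕ) : rawWeight b n = 1 / (n : ℝ) * tailSum b n := rfl

/-- The consequences of slow variation that the estimates use: beyond a threshold `V ≥ 1`,
`√u * b(u)` is non-decreasing and `b(u) / √u` is non-increasing. -/
structure HalfRegular (b : ℝ → ℝ) (V : ℝ) : Prop where
  one_le : 1 ≤ V
  pos : ∀ u, 1 / 2 ≤ u → 0 < b u
  mono : MonotoneOn (fun u : ℝ => u ^ (1 / 2 : ℝ) * b u) (Set.Ici V)
  anti : AntitoneOn (fun u : ℝ => u ^ (-(1 / 2) : ℝ) * b u) (Set.Ici V)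

lemma IsSlowlyVarying.exists_halfRegular {u₀ : ℝ} {b : ℝ → ℝ} (hb : IsSlowlyVarying u₀ b)
    (hu₀ : u₀ < 1 / 2) : ∃ V, HalfRegular b V := by
  obtain ⟨v, hv⟩ := hb.eventually_monotone (1 / 2) (by norm_num)
  obtain ⟨w, hw⟩ := hb.eventually_antitone (1 / 2) (by norm_num)
  refine ⟨max 1 (max v w), le_max_left _ _, fun u hu => hb.pos u (by linarith),
    hv.mono (Set.Ici_subset_Ici.2 ?_), hw.mono (Set.Ici_subset_Ici.2 ?_)⟩
  · exact (le_max_left v w).trans (le_max_right _ _)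
  · exact (le_max_right v w).trans (le_max_right _ _)

namespace HalfRegular

variable {b : ℝ → ℝ} {V : ℝ}

lemma pos_of_le (h : HalfRegular b V) {u : ℝ} (hu : V ≤ u) : 0 < b u :=
  h.pos u (by linarith [h.one_le])

lemma tailTerm_pos (h : HalfRegular b V) {u : ℝ} (hu : 1 / 2 ≤ u) : 0 < tailTerm b u := by
  have := h.pos u hu
  have : 0 < u := by linarith
  unfold tailTerm
  positivity

lemma tailTerm_antitone (h : HalfRegular b V) :
    AntitoneOn (fun u : ℝ => u ^ (5 / 4 : ℝ) * tailTerm b u) (Set.Ici V) := by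
  have key : ∀ u ∈ Set.Ici V, u ^ (5 / 4 : ℝ) * tailTerm b u =
      1 / Real.sqrt (u ^ (1 / 2 : ℝ) * b u) := by
    intro u hu
    have hu0 : 0 < u := by linarith [h.one_le, Set.mem_Ici.1 hu]
    have hbu := h.pos_of_le hu
    have e : u ^ 3 * b u = (u ^ (5 / 4 : ℝ)) ^ 2 * (u ^ (1 / 2 : ℝ) * b u) := by
      rw [← Real.rpow_natCast (u ^ (5 / 4 : ℝ)), ← Real.rpow_mul hu0.le, ← mul_assoc,
        ← Real.rpow_add hu0, ← Real.rpow_natCast u 3]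
      norm_num
    have hp := Real.rpow_pos_of_pos hu0 (5 / 4)
    rw [tailTerm, e, Real.sqrt_mul (by positivity), Real.sqrt_sq hp.le]
    have : 0 < Real.sqrt (u ^ (1 / 2 : ℝ) * b u) := by positivity
    field_simp
  intro u hu v hv huv
  simp only [key u hu, key v hv]
  have hu0 : 0 < u := by linarith [h.one_le, Set.mem_Ici.1 hu]
  have hbu := h.pos_of_le hu
  exact one_div_le_one_div_of_le (by positivity) (Real.sqrt_le_sqrt (h.mono hu hv huv))

lemma tailTerm_monotone (h : HalfRegular b V) :
    MonotoneOn (fun u : ℝ => u ^ (7 / 4 : ℝ) * tailTerm b u) (Set.Ici V) := by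
  have key : ∀ u ∈ Set.Ici V, u ^ (7 / 4 : ℝ) * tailTerm b u =
      1 / Real.sqrt (u ^ (-(1 / 2) : ℝ) * b u) := by
    intro u hu
    have hu0 : 0 < u := by linarith [h.one_le, Set.mem_Ici.1 hu]
    have hbu := h.pos_of_le hu
    have e : u ^ 3 * b u = (u ^ (7 / 4 : ℝ)) ^ 2 * (u ^ (-(1 / 2) : ℝ) * b u) := by
      rw [← Real.rpow_natCast (u ^ (7 / 4 : ℝ)), ← Real.rpow_mul hu0.le, ← mul_assoc,
        ← Real.rpow_add hu0, ← Real.rpow_natCast u 3]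
      norm_num
    have hp := Real.rpow_pos_of_pos hu0 (7 / 4)
    rw [tailTerm, e, Real.sqrt_mul (by positivity), Real.sqrt_sq hp.le]
    have : 0 < Real.sqrt (u ^ (-(1 / 2) : ℝ) * b u) := by positivity
    field_simp
  intro u hu v hv huv
  simp only [key u hu, key v hv]
  have hv0 : 0 < v := by linarith [h.one_le, Set.mem_Ici.1 hv]
  have hbv := h.pos_of_le hv
  exact one_div_le_one_div_of_le (by positivity) (Real.sqrt_le_sqrt (h.anti hu hv huv))

/-- The link between the weights and the function `u * b(u)` of the integral criterion. -/
lemma sq_mul_tailTerm (h : HalfRegular b V) {u : ℝ} (hu : 1 / 2 ≤ u) :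
    (u * tailTerm b u) ^ 2 = 1 / (u * b u) := by
  have hb := h.pos u hu
  have hu0 : 0 < u := by linarith
  rw [tailTerm, mul_pow, div_pow, Real.sq_sqrt (by positivity)]
  field_simp

lemma tail_tailTerm (h : HalfRegular b V) {u : ℝ} (hu : V ≤ u) {N : ℕ} (huN : u ≤ N) :
    Summable (fun j : ℕ => tailTerm b ((N + j : ℕ) : ℝ)) ∧
      tailSum b N ≤ 8 * (u * tailTerm b u) := by
  have := tail_le_of_antitoneOn h.one_le (by norm_num) (by norm_num)
    (fun v hv => (h.tailTerm_pos (by linarith [h.one_le])).le) h.tailTerm_antitone hu huN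
  norm_num at this
  exact_mod_cast this

lemma summable_tailTerm (h : HalfRegular b V) (n : ℕ) :
    Summable (fun j : ℕ => tailTerm b ((n + j : ℕ) : ℝ)) := by
  have h1 := (h.tail_tailTerm le_rfl (Nat.le_ceil V)).1
  have h2 : Summable (fun j : ℕ => tailTerm b (j : ℝ)) := by
    refine (summable_nat_add_iff ⌈V⌉₊).1 ?_
    simpa [add_comm] using h1
  simpa [add_comm] using (summable_nat_add_iff n).2 h2

lemma tailSum_pos (h : HalfRegular b V) {n : ℕ} (hn : 1 ≤ n) : 0 < tailSum b n := by
  have hpos : ∀ j : ℕ, 0 < tailTerm b ((n + j : ℕ) : ℝ) := fun j => h.tailTerm_pos (by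
    have : (1 : ℝ) ≤ ((n + j : ℕ) : ℝ) := by exact_mod_cast (by omega : 1 ≤ n + j)
    linarith)
  exact (h.summable_tailTerm n).tsum_pos (fun j => (hpos j).le) 0 (hpos 0)

lemma tailSum_succ (h : HalfRegular b V) (n : ℕ) :
    tailSum b n = tailTerm b n + tailSum b (n + 1) := by
  rw [tailSum, (h.summable_tailTerm n).tsum_eq_zero_add, tailSum]
  simp only [add_zero]
  congr 2
  ext j
  congr 2
  ring

lemma tailSum_antitone (h : HalfRegular b V) : Antitone (tailSum b) := by
  refine antitone_nat_of_succ_le fun n => ?_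
  rw [h.tailSum_succ n]
  have : 0 ≤ tailTerm b n := by unfold tailTerm; positivity
  linarith

/-- A tail is at least as large as its first block: with `N ≤ 5 * u`, the lower bound matching
`tail_tailTerm`. -/
lemma le_tailSum (h : HalfRegular b V) {u : ℝ} (hu : V ≤ u) {N : ℕ} (huN : u ≤ N)
    (hNu : (N : ℝ) ≤ 5 * u) : u * tailTerm b u / 100 ≤ tailSum b N := by
  have hu1 : 1 ≤ u := h.one_le.trans hu
  have hterm : ∀ j ∈ Finset.range N, tailTerm b u / 100 ≤ tailTerm b ((N + j : ℕ) : ℝ) := by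
    intro j hj
    have hjN : (j : ℝ) ≤ N := by exact_mod_cast (Finset.mem_range.1 hj).le
    set k : ℝ := ((N + j : ℕ) : ℝ) with hk
    have hku : u ≤ k := by rw [hk]; push_cast; linarith [j.cast_nonneg (α := ℝ)]
    have hk10 : k ≤ 10 * u := by rw [hk]; push_cast; linarith
    have h1 := h.tailTerm_monotone (Set.mem_Ici.2 hu) (Set.mem_Ici.2 (hu.trans hku)) hku
    simp only at h1
    have hup := Real.rpow_pos_of_pos (by linarith : 0 < u) (7 / 4)
    have hxk := h.tailTerm_pos (u := k) (by linarith)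
    have h2 : k ^ (7 / 4 : ℝ) ≤ 100 * u ^ (7 / 4 : ℝ) := by
      calc k ^ (7 / 4 : ℝ) ≤ (10 * u) ^ (7 / 4 : ℝ) :=
            Real.rpow_le_rpow (by linarith) hk10 (by norm_num)
        _ = 10 ^ (7 / 4 : ℝ) * u ^ (7 / 4 : ℝ) := Real.mul_rpow (by norm_num) (by linarith)
        _ ≤ 10 ^ (2 : ℝ) * u ^ (7 / 4 : ℝ) := by gcongr <;> norm_num
        _ = 100 * u ^ (7 / 4 : ℝ) := by norm_num
    have h3 : u ^ (7 / 4 : ℝ) * tailTerm b u ≤ u ^ (7 / 4 : ℝ) * (100 * tailTerm b k) := by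
      nlinarith [mul_le_mul_of_nonneg_right h2 hxk.le]
    have := le_of_mul_le_mul_left h3 hup
    linarith
  have hxu := h.tailTerm_pos (u := u) (by linarith)
  calc u * tailTerm b u / 100 ≤ N * (tailTerm b u / 100) := by
        rw [mul_div_assoc]; gcongr
    _ = ∑ j ∈ Finset.range N, tailTerm b u / 100 := by simp
    _ ≤ ∑ j ∈ Finset.range N, tailTerm b ((N + j : ℕ) : ℝ) := Finset.sum_le_sum hterm
    _ ≤ tailSum b N := (h.summable_tailTerm N).sum_le_tsum _ fun j _ => by
        unfold tailTerm; positivity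

end HalfRegular

/-! ### Renewal sequences -/

/-- The renewal sequence of the weights `p 0, p 1, …` (placed at `1, 2, …`): the coefficients of
the formal power series `1 / (1 - X * ∑ p_n X ^ n)`. -/
noncomputable def renewal (p : ℕ → ℝ) (n : ℕ) : ℝ :=
  PowerSeries.coeff n (1 - PowerSeries.X * PowerSeries.mk p)⁻¹

lemma renewal_powerSeries (p : ℕ → ℝ) :
    (1 - PowerSeries.X * PowerSeries.mk p)⁻¹ =
      1 + PowerSeries.X * (PowerSeries.mk p * (1 - PowerSeries.X * PowerSeries.mk p)⁻¹) := by
  have h := PowerSeries.mul_inv_cancel (1 - PowerSeries.X * PowerSeries.mk p)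
    (by simp)
  linear_combination h

lemma renewal_zero (p : ℕ → ℝ) : renewal p 0 = 1 := by
  rw [renewal, renewal_powerSeries]; simp

lemma renewal_succ (p : ℕ → ℝ) (n : ℕ) :
    renewal p (n + 1) = ∑ k ∈ Finset.range (n + 1), renewal p k * p (n - k) := by
  rw [renewal, renewal_powerSeries, map_add, PowerSeries.coeff_succ_X_mul, mul_comm,
    PowerSeries.coeff_mul,
    Finset.Nat.sum_antidiagonal_eq_sum_range_succ_mk]
  simp [PowerSeries.coeff_one, renewal]

/-- A strictly positive, non-increasing probability distribution on `ℕ` of infinite mean; the tails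
`∑_{i ≥ k} p_i` sum to the mean. -/
structure RenewalWeights (p : ℕ → ℝ) : Prop where
  pos : ∀ n, 0 < p n
  anti : Antitone p
  hasSum : HasSum p 1
  mean : ∀ C : ℝ, ∃ K : ℕ, C < ∑ i ∈ Finset.range K, ∑' j : ℕ, p (i + j)

/-- The coefficients of the remainder in
`(∑_{n ≤ M} a_n z ^ n) * (1 - ∑ p_n z ^ (n + 1)) = 1 - z ^ (M + 1) * ∑_j r_j z ^ j`.
In probabilistic terms, this is the distribution of the overshoot over the level `M`. -/
noncomputable def overshoot (p : ℕ → ℝ) (M j : ℕ) : ℝ :=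
  ∑ n ∈ Finset.range (M + 1), renewal p n * p (M - n + j)

lemma overshoot_zero (p : ℕ → ℝ) (j : ℕ) : overshoot p 0 j = p j := by
  simp [overshoot, renewal_zero]

lemma overshoot_apply_zero (p : ℕ → ℝ) (M : ℕ) : overshoot p M 0 = renewal p (M + 1) := by
  simp [overshoot, renewal_succ]

lemma overshoot_succ (p : ℕ → ℝ) (M j : ℕ) :
    overshoot p (M + 1) j = overshoot p M (j + 1) + renewal p (M + 1) * p j := by
  rw [overshoot, Finset.sum_range_succ, overshoot]
  congr 1
  · refine Finset.sum_congr rfl fun n hn => ?_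
    have := Finset.mem_range.1 hn
    congr 2
    omega
  · simp

namespace RenewalWeights

variable {p : ℕ → ℝ}

lemma summable_shift (h : RenewalWeights p) (k : ℕ) : Summable fun j => p (k + j) := by
  simpa [add_comm] using (summable_nat_add_iff k).2 h.hasSum.summable

lemma renewal_nonneg (h : RenewalWeights p) (n : ℕ) : 0 ≤ renewal p n := by
  induction n using Nat.strong_induction_on with
  | _ n ih =>
    cases n with
    | zero => rw [renewal_zero]; norm_num
    | succ n =>
      rw [renewal_succ]
      exact Finset.sum_nonneg fun k hk =>
        mul_nonneg (ih k (Finset.mem_range.1 hk)) (h.pos _).le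

lemma renewal_le_one (h : RenewalWeights p) (n : ℕ) : renewal p n ≤ 1 := by
  induction n using Nat.strong_induction_on with
  | _ n ih =>
    cases n with
    | zero => rw [renewal_zero]
    | succ n =>
      rw [renewal_succ]
      calc _ ≤ ∑ k ∈ Finset.range (n + 1), p (n - k) := by
            refine Finset.sum_le_sum fun k hk => ?_
            have := mul_le_mul_of_nonneg_right (ih k (Finset.mem_range.1 hk)) (h.pos (n - k)).le
            linarith
        _ = ∑ k ∈ Finset.range (n + 1), p k := by
            simpa using Finset.sum_range_reflect p (n + 1)
        _ ≤ 1 := sum_le_hasSum _ (fun i _ => (h.pos i).le) h.hasSum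

lemma overshoot_nonneg (h : RenewalWeights p) (M j : ℕ) : 0 ≤ overshoot p M j :=
  Finset.sum_nonneg fun n _ => mul_nonneg (h.renewal_nonneg n) (h.pos _).le

lemma overshoot_antitone (h : RenewalWeights p) (M : ℕ) : Antitone (overshoot p M) :=
  fun _ _ hij => Finset.sum_le_sum fun n _ =>
    mul_le_mul_of_nonneg_left (h.anti (by omega)) (h.renewal_nonneg n)

lemma hasSum_overshoot_eq (h : RenewalWeights p) (M : ℕ) :
    HasSum (overshoot p M)
      (∑ n ∈ Finset.range (M + 1), renewal p n * ∑' j, p (M - n + j)) :=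
  hasSum_sum fun _ _ => ((h.summable_shift _).hasSum).mul_left _

lemma hasSum_overshoot (h : RenewalWeights p) (M : ℕ) : HasSum (overshoot p M) 1 := by
  induction M with
  | zero => simpa [funext (overshoot_zero p)] using h.hasSum
  | succ M ih =>
    have h1 : HasSum (fun j => overshoot p M (j + 1)) (1 - overshoot p M 0) := by
      simpa using (hasSum_nat_add_iff' 1).2 ih
    have h2 := h1.add (h.hasSum.mul_left (renewal p (M + 1)))
    simp only [← overshoot_succ] at h2
    convert h2 using 1
    rw [overshoot_apply_zero]; ring

lemma summable_mul_pow {q : ℕ → ℝ} (hq0 : ∀ n, 0 ≤ q n) (hq : Summable q) {z : ℂ} (hz : ‖z‖ ≤ 1) :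
    Summable fun n => ‖(q n : ℂ) * z ^ n‖ := by
  refine Summable.of_nonneg_of_le (fun _ => norm_nonneg _) (fun n => ?_) hq
  rw [norm_mul, norm_pow, Complex.norm_real, Real.norm_of_nonneg (hq0 n)]
  exact mul_le_of_le_one_right (hq0 n) (pow_le_one₀ (norm_nonneg _) hz)

lemma norm_tsum_mul_pow_le {q : ℕ → ℝ} (hq0 : ∀ n, 0 ≤ q n) {s : ℝ} (hq : HasSum q s)
    {z : ℂ} (hz : ‖z‖ ≤ 1) : ‖∑' n, (q n : ℂ) * z ^ n‖ ≤ s := by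
  refine tsum_of_norm_bounded hq fun n => ?_
  rw [norm_mul, norm_pow, Complex.norm_real, Real.norm_of_nonneg (hq0 n)]
  exact mul_le_of_le_one_right (hq0 n) (pow_le_one₀ (norm_nonneg _) hz)

/-- Abel summation: a power series with non-increasing coefficients is `O(q_0 / |1 - z|)`. -/
lemma norm_one_sub_mul_tsum_le {q : ℕ → ℝ} (hq0 : ∀ n, 0 ≤ q n) (hanti : Antitone q)
    (hq : Summable q) {z : ℂ} (hz : ‖z‖ ≤ 1) :
    ‖(1 - z) * ∑' n, (q n : ℂ) * z ^ n‖ ≤ 2 * q 0 := by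
  have hs := (summable_mul_pow hq0 hq hz).of_norm
  have hd0 : ∀ n, 0 ≤ q n - q (n + 1) := fun n => sub_nonneg.2 (hanti n.le_succ)
  have hd : HasSum (fun n => q n - q (n + 1)) (q 0) := by
    have h1 : HasSum (fun n => q (n + 1)) (∑' n, q n - q 0) := by
      simpa using (hasSum_nat_add_iff' 1).2 hq.hasSum
    simpa using hq.hasSum.sub h1
  have hds := (summable_mul_pow hd0 hd.summable hz).of_norm
  have key : (1 - z) * ∑' n, (q n : ℂ) * z ^ n =
      q 0 - z * ∑' n, ((q n - q (n + 1) : ℝ) : ℂ) * z ^ n := by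
    have e1 : ∑' n, (q n : ℂ) * z ^ n = q 0 + ∑' n, (q (n + 1) : ℂ) * z ^ (n + 1) := by
      rw [hs.tsum_eq_zero_add]; simp
    have hs1 : Summable fun n => (q (n + 1) : ℂ) * z ^ (n + 1) := (summable_nat_add_iff 1).2 hs
    have e2 : z * ∑' n, ((q n - q (n + 1) : ℝ) : ℂ) * z ^ n =
        z * (∑' n, (q n : ℂ) * z ^ n) - ∑' n, (q (n + 1) : ℂ) * z ^ (n + 1) := by
      rw [← tsum_mul_left, ← tsum_mul_left, ← (hs.mul_left z).tsum_sub hs1]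
      congr 1
      ext n
      push_cast
      ring
    rw [e2, sub_mul, one_mul]
    linear_combination e1
  rw [key]
  calc _ ≤ ‖(q 0 : ℂ)‖ + ‖z * ∑' n, ((q n - q (n + 1) : ℝ) : ℂ) * z ^ n‖ := norm_sub_le _ _
    _ ≤ q 0 + 1 * q 0 := by
        rw [Complex.norm_real, Real.norm_of_nonneg (hq0 0), norm_mul]
        gcongr
        · exact norm_tsum_mul_pow_le hd0 hd hz
    _ = 2 * q 0 := by ring

/-- Multiplying a partial sum of `∑ a_n z ^ n` by `1 - ∑ p_n z ^ (n + 1)` leaves `1` and a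
remainder with coefficients of one sign. -/
lemma partial_sum_mul (h : RenewalWeights p) {z : ℂ} (hz : ‖z‖ ≤ 1) (M : ℕ) :
    (∑ n ∈ Finset.range (M + 1), (renewal p n : ℂ) * z ^ n) *
        (1 - z * ∑' n, (p n : ℂ) * z ^ n) =
      1 - z ^ (M + 1) * ∑' j, (overshoot p M j : ℂ) * z ^ j := by
  induction M with
  | zero => simp [renewal_zero, overshoot_zero]
  | succ M ih =>
    have hs := (summable_mul_pow (h.overshoot_nonneg M) (h.hasSum_overshoot M).summable hz).of_norm
    have hp := (summable_mul_pow (fun n => (h.pos n).le) h.hasSum.summable hz).of_norm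
    have hs1 : Summable fun j => (overshoot p M (j + 1) : ℂ) * z ^ (j + 1) :=
      (summable_nat_add_iff 1).2 hs
    have e1 : ∑' j, (overshoot p M j : ℂ) * z ^ j =
        renewal p (M + 1) + ∑' j, (overshoot p M (j + 1) : ℂ) * z ^ (j + 1) := by
      rw [hs.tsum_eq_zero_add, overshoot_apply_zero]; simp
    have e2 : z * ∑' j, (overshoot p (M + 1) j : ℂ) * z ^ j =
        ∑' j, (overshoot p M (j + 1) : ℂ) * z ^ (j + 1) +
          renewal p (M + 1) * z * ∑' n, (p n : ℂ) * z ^ n := by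
      rw [← tsum_mul_left, ← tsum_mul_left, ← hs1.tsum_add (hp.mul_left _)]
      congr 1
      ext j
      rw [overshoot_succ]
      push_cast
      ring
    rw [Finset.sum_range_succ, add_mul, ih, e1]
    linear_combination z ^ (M + 1) * e2

/-- The domination that makes the criterion work: partial sums of `∑ a_n z ^ n` are bounded, up to
a factor `2`, by the sum of the series, uniformly on the closed disk. -/
lemma norm_partial_sum_mul_le (h : RenewalWeights p) {z : ℂ} (hz : ‖z‖ ≤ 1) (N : ℕ) :
    ‖(∑ n ∈ Finset.range N, (renewal p n : ℂ) * z ^ n) *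
        (1 - z * ∑' n, (p n : ℂ) * z ^ n)‖ ≤ 2 := by
  cases N with
  | zero => simp
  | succ M =>
    rw [h.partial_sum_mul hz]
    have h1 := norm_tsum_mul_pow_le (h.overshoot_nonneg M) (h.hasSum_overshoot M) hz
    have h2 : ‖z ^ (M + 1)‖ ≤ 1 := by
      rw [norm_pow]; exact pow_le_one₀ (norm_nonneg _) hz
    calc _ ≤ ‖(1 : ℂ)‖ + ‖z ^ (M + 1) * ∑' j, (overshoot p M j : ℂ) * z ^ j‖ := norm_sub_le _ _
      _ ≤ 1 + 1 * 1 := by rw [norm_one, norm_mul]; gcongr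
      _ = 2 := by norm_num

/-- If `a_n` is close to its limit superior, so is each earlier term `a_(n - 1 - i)`, because `a_n`
is an average of the earlier terms in which `a_(n - 1 - i)` has the positive weight `p_i`. -/
lemma eventually_renewal_ge (h : RenewalWeights p) {l : ℝ}
    (hl : ∀ ε > 0, ∀ᶠ n in atTop, renewal p n ≤ l + ε) (i : ℕ) {ε : ℝ} (hε : 0 < ε) :
    ∃ η > 0, ∀ᶠ n in atTop, l - η ≤ renewal p (n + i + 1) → l - ε ≤ renewal p n := by
  have hl0 : 0 ≤ l := by
    refine le_of_forall_pos_le_add fun δ hδ => ?_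
    obtain ⟨n, hn⟩ := (hl δ hδ).exists
    exact (h.renewal_nonneg n).trans hn
  have hpi := h.pos i
  set η : ℝ := ε * p i / 3 with hη
  have hη0 : 0 < η := by positivity
  obtain ⟨M, hM⟩ := eventually_atTop.1 (hl η hη0)
  have htail : Tendsto (fun N => ∑ k ∈ Finset.range N, p k) atTop (𝓝 1) :=
    h.hasSum.tendsto_sum_nat
  have hev : ∀ᶠ n : ℕ in atTop, 1 - η < ∑ k ∈ Finset.range (n + i + 1 - M), p k := by
    have ht : Tendsto (fun n : ℕ => n + i + 1 - M) atTop atTop := by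
      refine tendsto_atTop_mono (fun n => ?_) (tendsto_sub_atTop_nat M)
      omega
    exact (htail.comp ht).eventually (lt_mem_nhds (by linarith))
  refine ⟨η, hη0, ?_⟩
  filter_upwards [hev, eventually_ge_atTop M] with n hn hnM hge
  set m := n + i with hm
  -- Reindexing by the age `k = m - j` makes `p k` the weight of `a (m - k)`.
  have e : renewal p (m + 1) = ∑ k ∈ Finset.range (m + 1), renewal p (m - k) * p k := by
    rw [renewal_succ, ← Finset.sum_range_reflect]
    refine Finset.sum_congr rfl fun k hk => ?_
    have := Finset.mem_range.1 hk
    congr 2; omega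
  have hsplit : ∑ k ∈ Finset.range (m + 1), renewal p (m - k) * p k =
      ∑ k ∈ Finset.range (m + 1 - M), renewal p (m - k) * p k +
        ∑ k ∈ Finset.Ico (m + 1 - M) (m + 1), renewal p (m - k) * p k :=
    (Finset.sum_range_add_sum_Ico _ (by omega)).symm
  have hfar : ∑ k ∈ Finset.Ico (m + 1 - M) (m + 1), renewal p (m - k) * p k ≤ η := by
    have h1 : ∑ k ∈ Finset.Ico (m + 1 - M) (m + 1), renewal p (m - k) * p k ≤
        ∑ k ∈ Finset.Ico (m + 1 - M) (m + 1), p k := Finset.sum_le_sum fun k _ => by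
      have := mul_le_mul_of_nonneg_right (h.renewal_le_one (m - k)) (h.pos k).le
      linarith
    have h2 : ∑ k ∈ Finset.range (m + 1 - M), p k +
        ∑ k ∈ Finset.Ico (m + 1 - M) (m + 1), p k ≤ 1 := by
      rw [Finset.sum_range_add_sum_Ico _ (by omega)]
      exact sum_le_hasSum _ (fun k _ => (h.pos k).le) h.hasSum
    linarith
  have hi : i ∈ Finset.range (m + 1 - M) := Finset.mem_range.2 (by omega)
  have hnear : ∑ k ∈ Finset.range (m + 1 - M), renewal p (m - k) * p k ≤
      (l + η) * (1 - p i) + renewal p n * p i := by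
    rw [← Finset.sum_erase_add _ _ hi]
    have e1 : m - i = n := by omega
    rw [e1]
    have h1 : ∑ k ∈ (Finset.range (m + 1 - M)).erase i, renewal p (m - k) * p k ≤
        ∑ k ∈ (Finset.range (m + 1 - M)).erase i, (l + η) * p k :=
      Finset.sum_le_sum fun k hk => by
        have hk' := Finset.mem_range.1 (Finset.mem_of_mem_erase hk)
        exact mul_le_mul_of_nonneg_right (hM _ (by omega)) (h.pos k).le
    have h2 : ∑ k ∈ (Finset.range (m + 1 - M)).erase i, p k + p i ≤ 1 := by
      rw [Finset.sum_erase_add _ _ hi]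
      exact sum_le_hasSum _ (fun k _ => (h.pos k).le) h.hasSum
    rw [← Finset.mul_sum] at h1
    nlinarith
  have hp1 : p i ≤ 1 := by
    simpa using sum_le_hasSum {i} (fun k _ => (h.pos k).le) h.hasSum
  have h3 : p i * (l - ε) ≤ p i * renewal p n := by
    have : η * (1 - p i) ≤ η := by nlinarith
    have h4 : 3 * η = ε * p i := by rw [hη]; ring
    nlinarith
  exact le_of_mul_le_mul_left h3 hpi

/-- The renewal theorem for a distribution of infinite mean (Erdős, Feller and Pollard). -/
lemma tendsto_renewal (h : RenewalWeights p) : Tendsto (renewal p) atTop (𝓝 0) := by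
  have hbdd : IsBoundedUnder (· ≤ ·) atTop (renewal p) :=
    isBoundedUnder_of ⟨1, h.renewal_le_one⟩
  have hcob : IsCoboundedUnder (· ≤ ·) atTop (renewal p) :=
    (isBoundedUnder_of ⟨0, h.renewal_nonneg⟩ : IsBoundedUnder (· ≥ ·) atTop _).isCoboundedUnder_le
  set l := limsup (renewal p) atTop with hl
  have hup : ∀ ε > 0, ∀ᶠ n in atTop, renewal p n ≤ l + ε := fun ε hε =>
    (eventually_lt_of_limsup_lt (show l < l + ε by linarith) hbdd).mono fun _ hn => hn.le
  have hl0 : l ≤ 0 := by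
    by_contra hpos
    push Not at hpos
    obtain ⟨K, hK⟩ := h.mean (2 / l)
    have hchoose : ∀ i : ℕ, ∃ η > 0, ∀ᶠ n in atTop,
        l - η ≤ renewal p (n + i + 1) → l - l / 2 ≤ renewal p n :=
      fun i => h.eventually_renewal_ge hup i (half_pos hpos)
    choose η hη0 hη using hchoose
    obtain ⟨δ, hδ0, hδ⟩ : ∃ δ > 0, ∀ i ∈ Finset.range K, δ ≤ η i := by
      clear hK
      induction K with
      | zero => exact ⟨1, one_pos, by simp⟩
      | succ K ih =>
        obtain ⟨δ, hδ0, hδ⟩ := ih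
        refine ⟨min δ (η K), lt_min hδ0 (hη0 K), fun i hi => ?_⟩
        rcases Nat.lt_succ_iff_lt_or_eq.1 (Finset.mem_range.1 hi) with hi | rfl
        · exact (min_le_left _ _).trans (hδ i (Finset.mem_range.2 hi))
        · exact min_le_right _ _
    have hfreq : ∃ᶠ n in atTop, l - δ < renewal p n :=
      frequently_lt_of_lt_limsup hcob (by linarith)
    have hall : ∀ᶠ n in atTop, ∀ i ∈ Finset.range K,
        l - η i ≤ renewal p n → l - l / 2 ≤ renewal p (n - (i + 1)) := by
      rw [eventually_all_finset]
      intro i _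
      filter_upwards [(tendsto_sub_atTop_nat (i + 1)).eventually (hη i),
        eventually_ge_atTop (i + 1)] with n hn hni
      have e : n - (i + 1) + i + 1 = n := by omega
      rwa [e] at hn
    obtain ⟨n, hn, hall, hnK⟩ := (hfreq.and_eventually
      (hall.and (eventually_ge_atTop (K + 1)))).exists
    obtain ⟨M, rfl⟩ : ∃ M, n = M + 1 := ⟨n - 1, by omega⟩
    have h1 : ∑ i ∈ Finset.range K, (l / 2) * ∑' j, p (i + j) ≤
        ∑ k ∈ Finset.range (M + 1), renewal p k * ∑' j, p (M - k + j) := by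
      rw [← Finset.sum_range_reflect (n := M + 1)]
      have ht : ∀ i, 0 ≤ ∑' j, p (i + j) := fun i => tsum_nonneg fun j => (h.pos _).le
      calc _ ≤ ∑ i ∈ Finset.range K, renewal p (M - i) * ∑' j, p (i + j) := by
            refine Finset.sum_le_sum fun i hi => mul_le_mul_of_nonneg_right ?_ (ht i)
            have := hall i hi (by linarith [hδ i hi])
            have e : M + 1 - (i + 1) = M - i := by omega
            rw [e] at this
            linarith
        _ ≤ ∑ i ∈ Finset.range (M + 1), renewal p (M - i) * ∑' j, p (i + j) := by
            refine Finset.sum_le_sum_of_subset_of_nonneg ?_ fun i _ _ =>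
              mul_nonneg (h.renewal_nonneg _) (ht i)
            intro i hi
            have := Finset.mem_range.1 hi
            exact Finset.mem_range.2 (by omega)
        _ = _ := by
            refine Finset.sum_congr rfl fun i hi => ?_
            have := Finset.mem_range.1 hi
            have e1 : M + 1 - 1 - i = M - i := by omega
            have e2 : M - (M + 1 - 1 - i) = i := by omega
            rw [e2, e1]
    rw [(h.hasSum_overshoot_eq M).unique (h.hasSum_overshoot M), ← Finset.mul_sum] at h1
    have h2 : 1 < l / 2 * ∑ i ∈ Finset.range K, ∑' j, p (i + j) := by
      calc (1 : ℝ) = l / 2 * (2 / l) := by field_simp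
        _ < _ := mul_lt_mul_of_pos_left hK (half_pos hpos)
    linarith
  rw [tendsto_order]
  refine ⟨fun a ha => Eventually.of_forall fun n => ha.trans_le (h.renewal_nonneg n), fun a ha => ?_⟩
  exact eventually_lt_of_limsup_lt (hl0.trans_lt ha) hbdd

lemma tendsto_partial_sum_mul (h : RenewalWeights p) {z : ℂ} (hz : ‖z‖ ≤ 1) (hz1 : z ≠ 1) :
    Tendsto (fun N => (∑ n ∈ Finset.range N, (renewal p n : ℂ) * z ^ n) *
        (1 - z * ∑' n, (p n : ℂ) * z ^ n)) atTop (𝓝 1) := by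
  rw [← tendsto_add_atTop_iff_nat 1]
  simp only [h.partial_sum_mul hz]
  have h0 : 0 < ‖1 - z‖ := norm_pos_iff.2 (sub_ne_zero.2 hz1.symm)
  have hlim : Tendsto (fun M => 2 * renewal p (M + 1) / ‖1 - z‖) atTop (𝓝 0) := by
    have := ((tendsto_add_atTop_iff_nat 1).2 h.tendsto_renewal).const_mul 2 |>.div_const ‖1 - z‖
    simpa using this
  have hR : Tendsto (fun M => z ^ (M + 1) * ∑' j, (overshoot p M j : ℂ) * z ^ j) atTop (𝓝 0) := by
    refine squeeze_zero_norm (fun M => ?_) hlim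
    have h1 := norm_one_sub_mul_tsum_le (h.overshoot_nonneg M) (h.overshoot_antitone M)
      (h.hasSum_overshoot M).summable hz
    rw [overshoot_apply_zero, norm_mul] at h1
    rw [le_div_iff₀ h0, norm_mul, norm_pow]
    calc _ ≤ 1 * ‖∑' j, (overshoot p M j : ℂ) * z ^ j‖ * ‖1 - z‖ := by
          gcongr; exact pow_le_one₀ (norm_nonneg _) hz
      _ ≤ _ := by linarith
  simpa using hR.const_sub 1

/-- The renewal sequence is not summable: otherwise evaluation at `1` of
`a = 1 + X * p * a` would give `∑ a_n = 1 + ∑ a_n`. -/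
lemma not_summable_renewal (h : RenewalWeights p) : ¬ Summable (renewal p) := by
  intro hs
  have hprod := tsum_mul_tsum_eq_tsum_sum_range_of_summable_norm (f := renewal p) (g := p)
    hs.norm h.hasSum.summable.norm
  simp only [← renewal_succ, h.hasSum.tsum_eq, mul_one] at hprod
  rw [hs.tsum_eq_zero_add, renewal_zero] at hprod
  linarith

lemma tendsto_sum_renewal (h : RenewalWeights p) :
    Tendsto (fun N => ∑ n ∈ Finset.range N, renewal p n) atTop atTop :=
  (not_summable_iff_tendsto_nat_atTop_of_nonneg h.renewal_nonneg).1 h.not_summable_renewal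

end RenewalWeights

/-! ### The weights `γ_n` -/

/-- The weight at `0` is a junk value, the reciprocal of `0`; it lets sums start at `0`. -/
lemma gammaCoeff_zero (b : ℝ → ℝ) : gammaCoeff b 0 = 0 := by
  simp [gammaCoeff, rawWeight]

lemma seriesB_eq (b : ℝ → ℝ) (z : ℂ) :
    seriesB b z = z * ∑' n : ℕ, (gammaCoeff b (n + 1) : ℂ) * z ^ n := by
  rw [seriesB, ← tsum_mul_left]
  congr 1
  ext n
  ring

namespace HalfRegular

variable {b : ℝ → ℝ} {V : ℝ}

lemma rawWeight_pos (h : HalfRegular b V) (n : ℕ) : 0 < rawWeight b (n + 1) := by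
  rw [rawWeight_eq]
  have := h.tailSum_pos (n := n + 1) (by omega)
  positivity

lemma rawWeight_le_tailTerm (h : HalfRegular b V) {n : ℕ} (hn : V ≤ n) :
    rawWeight b n ≤ 8 * tailTerm b n := by
  have hn0 : (0 : ℝ) < n := by linarith [h.one_le]
  have h1 := (h.tail_tailTerm hn le_rfl).2
  rw [rawWeight_eq, one_div_mul_eq_div, div_le_iff₀ hn0]
  linarith

lemma summable_rawWeight (h : HalfRegular b V) : Summable (rawWeight b) := by
  refine (summable_nat_add_iff (f := rawWeight b) ⌈V⌉₊).1 ?_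
  have hs : Summable fun n : ℕ => 8 * tailTerm b ((n + ⌈V⌉₊ : ℕ) : ℝ) := by
    simpa [add_comm] using (h.summable_tailTerm ⌈V⌉₊).mul_left 8
  refine Summable.of_nonneg_of_le (fun n => ?_) (fun n => ?_) hs
  · rw [rawWeight_eq]
    refine mul_nonneg (by positivity) (tsum_nonneg fun j => ?_)
    unfold tailTerm
    positivity
  · refine h.rawWeight_le_tailTerm ?_
    push_cast
    linarith [Nat.le_ceil V, n.cast_nonneg (α := ℝ)]

lemma normConst_pos (h : HalfRegular b V) : 0 < normConst b :=
  inv_pos.2 (((summable_nat_add_iff 1).2 h.summable_rawWeight).tsum_pos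
    (fun n => (h.rawWeight_pos n).le) 0 (h.rawWeight_pos 0))

lemma gammaCoeff_nonneg (h : HalfRegular b V) (n : ℕ) : 0 ≤ gammaCoeff b n := by
  cases n with
  | zero => rw [gammaCoeff_zero]
  | succ n => exact (mul_pos h.normConst_pos (h.rawWeight_pos n)).le

lemma hasSum_gammaCoeff_succ (h : HalfRegular b V) :
    HasSum (fun n => gammaCoeff b (n + 1)) 1 := by
  have hs := (summable_nat_add_iff 1).2 h.summable_rawWeight
  have h0 : (∑' n : ℕ, rawWeight b (n + 1)) ≠ 0 := fun h0 => by
    have := h.normConst_pos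
    rw [normConst, h0] at this
    simp at this
  have h1 := hs.hasSum.mul_left (normConst b)
  rwa [normConst, inv_mul_cancel₀ h0] at h1

lemma hasSum_gammaCoeff (h : HalfRegular b V) : HasSum (gammaCoeff b) 1 := by
  have := (hasSum_nat_add_iff 1).1 h.hasSum_gammaCoeff_succ
  simpa [gammaCoeff_zero] using this

lemma nat_mul_gammaCoeff {n : ℕ} (hn : 1 ≤ n) :
    (n : ℝ) * gammaCoeff b n = normConst b * tailSum b n := by
  have : (n : ℝ) ≠ 0 := by positivity
  rw [gammaCoeff, rawWeight_eq]
  field_simp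

lemma gammaCoeff_succ_antitone (h : HalfRegular b V) :
    Antitone fun n => gammaCoeff b (n + 1) := by
  intro m n hmn
  refine mul_le_mul_of_nonneg_left ?_ h.normConst_pos.le
  rw [rawWeight_eq, rawWeight_eq]
  have h1 := h.tailSum_antitone (show m + 1 ≤ n + 1 by omega)
  have h2 := h.tailSum_pos (n := n + 1) (by omega)
  have h3 : (1 : ℝ) / ((n + 1 : ℕ) : ℝ) ≤ 1 / ((m + 1 : ℕ) : ℝ) :=
    one_div_le_one_div_of_le (by positivity) (by exact_mod_cast (by omega))
  exact mul_le_mul h3 h1 h2.le (by positivity)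

/-- `1 / (u * √(u b(u)))` decays no faster than a multiple of `u ^ (-7 / 4)`, hence of `u ^ (-2)`. -/
lemma exists_le_sq_mul_tailTerm (h : HalfRegular b V) :
    ∃ κ > 0, ∀ u, V ≤ u → κ ≤ u ^ 2 * tailTerm b u := by
  have hV0 : 0 < V := by linarith [h.one_le]
  have hx := h.tailTerm_pos (u := V) (by linarith [h.one_le])
  refine ⟨V ^ (7 / 4 : ℝ) * tailTerm b V, by positivity, fun u hu => ?_⟩
  have hxu := h.tailTerm_pos (u := u) (by linarith [h.one_le])
  refine (h.tailTerm_monotone (Set.mem_Ici.2 le_rfl) (Set.mem_Ici.2 hu) hu).trans ?_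
  refine mul_le_mul_of_nonneg_right ?_ hxu.le
  rw [← Real.rpow_natCast u 2]
  exact Real.rpow_le_rpow_of_exponent_le (h.one_le.trans hu) (by norm_num)

/-- The mean of the weights is infinite, as `n * γ_n` is at least a multiple of `1 / n`. -/
lemma renewalWeights (h : HalfRegular b V) : RenewalWeights fun n => gammaCoeff b (n + 1) where
  pos n := mul_pos h.normConst_pos (h.rawWeight_pos n)
  anti := h.gammaCoeff_succ_antitone
  hasSum := h.hasSum_gammaCoeff_succ
  mean := by
    set p : ℕ → ℝ := fun n => gammaCoeff b (n + 1) with hp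
    have hp0 : ∀ n, 0 ≤ p n := fun n => h.gammaCoeff_nonneg _
    have ht0 : ∀ i, 0 ≤ ∑' j : ℕ, p (i + j) := fun i => tsum_nonneg fun j => hp0 _
    have hc := h.normConst_pos
    have hns : ¬ Summable fun i => ∑' j : ℕ, p (i + j) := by
      intro hs
      obtain ⟨κ, hκ, hκu⟩ := h.exists_le_sq_mul_tailTerm
      set K := normConst b * κ / 400 with hK
      have hK0 : 0 < K := by positivity
      have hle : ∀ i : ℕ, V ≤ i → K * (1 / ((i + 1 : ℕ) : ℝ)) ≤ ∑' j : ℕ, p (i + j) := by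
        intro i hi
        have hsum : Summable fun j => p (i + j) := by
          simpa [add_comm] using (summable_nat_add_iff i).2 h.hasSum_gammaCoeff_succ.summable
        have h1 : ((i + 1 : ℕ) : ℝ) * p (2 * i) ≤ ∑' j : ℕ, p (i + j) := by
          calc _ = ∑ j ∈ Finset.range (i + 1), p (2 * i) := by simp
            _ ≤ ∑ j ∈ Finset.range (i + 1), p (i + j) :=
              Finset.sum_le_sum fun j hj => h.gammaCoeff_succ_antitone (by
                have := Finset.mem_range.1 hj; omega)
            _ ≤ _ := hsum.sum_le_tsum _ fun j _ => hp0 _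
        refine le_trans ?_ h1
        set u : ℝ := ((2 * i + 1 : ℕ) : ℝ) with hu
        have hui : u = 2 * i + 1 := by rw [hu]; push_cast; ring
        have hi0 : (0 : ℝ) ≤ i := i.cast_nonneg
        have hu0 : 0 < u := by linarith
        have h2 : u * p (2 * i) = normConst b * tailSum b (2 * i + 1) :=
          nat_mul_gammaCoeff (by omega)
        have h3 := h.le_tailSum (u := u) (by linarith) (N := 2 * i + 1) le_rfl (by linarith)
        have h4 : κ ≤ u * (u * tailTerm b u) := by
          have := hκu u (by linarith)
          linarith
        have h5 : normConst b * κ / 100 ≤ u ^ 2 * p (2 * i) := by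
          have e : u ^ 2 * p (2 * i) = normConst b * (u * tailSum b (2 * i + 1)) := by
            rw [sq, mul_assoc, h2]; ring
          rw [e, mul_div_assoc]
          refine mul_le_mul_of_nonneg_left ?_ hc.le
          have := mul_le_mul_of_nonneg_left h3 hu0.le
          linarith
        have hi1 : (0 : ℝ) < ((i + 1 : ℕ) : ℝ) := by positivity
        rw [mul_one_div, div_le_iff₀ hi1, hK]
        have h6 : u ≤ 2 * ((i + 1 : ℕ) : ℝ) := by push_cast; linarith
        have h7 : u ^ 2 ≤ 4 * ((i + 1 : ℕ) : ℝ) ^ 2 := by nlinarith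
        nlinarith [mul_le_mul_of_nonneg_right h7 (hp0 (2 * i))]
      have h1 : Summable fun i : ℕ => K * (1 / ((i + 1 : ℕ) : ℝ)) := by
        refine (summable_nat_add_iff ⌈V⌉₊).1 ?_
        refine Summable.of_nonneg_of_le (fun i => by positivity) (fun i => hle _ ?_)
          ((summable_nat_add_iff ⌈V⌉₊).2 hs)
        push_cast
        linarith [Nat.le_ceil V, i.cast_nonneg (α := ℝ)]
      have h2 := (summable_mul_left_iff hK0.ne').1 h1
      exact Real.not_summable_one_div_natCast
        ((summable_nat_add_iff (f := fun n : ℕ => 1 / (n : ℝ)) 1).1 h2)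
    have ht := (not_summable_iff_tendsto_nat_atTop_of_nonneg ht0).1 hns
    intro C
    exact (ht.eventually_gt_atTop C).exists

/-! ### The size of `1 - B` on the closed disk -/

lemma hasSum_one_sub_seriesB (h : HalfRegular b V) {z : ℂ} (hz : ‖z‖ ≤ 1) :
    HasSum (fun n => (gammaCoeff b n : ℂ) * (1 - z ^ n)) (1 - seriesB b z) := by
  have h1 : HasSum (fun n => (gammaCoeff b n : ℂ)) ((1 : ℝ) : ℂ) :=
    Complex.hasSum_ofReal.2 h.hasSum_gammaCoeff
  rw [Complex.ofReal_one] at h1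
  have hs := (RenewalWeights.summable_mul_pow h.gammaCoeff_nonneg
    h.hasSum_gammaCoeff.summable hz).of_norm
  have h2 : ∑' n, (gammaCoeff b n : ℂ) * z ^ n = seriesB b z := by
    rw [hs.tsum_eq_zero_add, seriesB]
    simp [gammaCoeff_zero]
  have h3 := h1.sub hs.hasSum
  rw [h2] at h3
  simpa only [mul_sub, mul_one] using h3

end HalfRegular

lemma norm_sum_pow_mul_le {z : ℂ} (hz : ‖z‖ ≤ 1) (N : ℕ) :
    ‖∑ k ∈ Finset.Icc 1 N, z ^ k‖ * ‖1 - z‖ ≤ 2 := by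
  have e : (∑ k ∈ Finset.Icc 1 N, z ^ k) * (1 - z) = z * (1 - z ^ N) := by
    induction N with
    | zero => simp
    | succ n ih => rw [Finset.sum_Icc_succ_top (by omega), add_mul, ih]; ring
  rw [← norm_mul, e, norm_mul]
  have h1 : ‖1 - z ^ N‖ ≤ 2 := by
    calc _ ≤ ‖(1 : ℂ)‖ + ‖z ^ N‖ := norm_sub_le _ _
      _ ≤ 1 + 1 := by
        rw [norm_one, norm_pow]; gcongr; exact pow_le_one₀ (norm_nonneg _) hz
      _ = 2 := by norm_num
  calc _ ≤ 1 * 2 := mul_le_mul hz h1 (norm_nonneg _) zero_le_one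
    _ = 2 := by norm_num

lemma norm_sum_pow_le_natCast {z : ℂ} (hz : ‖z‖ ≤ 1) (N : ℕ) :
    ‖∑ k ∈ Finset.Icc 1 N, z ^ k‖ ≤ N := by
  refine (norm_sum_le_of_le _ (n := fun _ => (1 : ℝ)) fun k _ => ?_).trans (by simp)
  rw [norm_pow]
  exact pow_le_one₀ (norm_nonneg _) hz

lemma norm_one_sub_pow_le {z : ℂ} (hz : ‖z‖ ≤ 1) (n : ℕ) : ‖1 - z ^ n‖ ≤ n * ‖1 - z‖ := by
  rw [← mul_neg_geom_sum, norm_mul, mul_comm]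
  refine mul_le_mul_of_nonneg_right ?_ (norm_nonneg _)
  refine (norm_sum_le_of_le _ (n := fun _ => (1 : ℝ)) fun k _ => ?_).trans (by simp)
  rw [norm_pow]
  exact pow_le_one₀ (norm_nonneg _) hz

lemma half_le_norm_sum_pow {z : ℂ} (hz : ‖z‖ ≤ 1) {N : ℕ} (hN : (N : ℝ) * ‖1 - z‖ ≤ 1 / 2) :
    (N : ℝ) / 2 ≤ ‖∑ k ∈ Finset.Icc 1 N, z ^ k‖ := by
  have h1 : ‖∑ k ∈ Finset.Icc 1 N, (1 - z ^ k)‖ ≤ N / 2 := by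
    refine (norm_sum_le_of_le _ (n := fun _ => (1 / 2 : ℝ)) fun k hk => ?_).trans
      (by simp; linarith)
    refine (norm_one_sub_pow_le hz k).trans (le_trans ?_ hN)
    gcongr
    exact (Finset.mem_Icc.1 hk).2
  have h2 : ∑ k ∈ Finset.Icc 1 N, (1 - z ^ k) = (N : ℂ) - ∑ k ∈ Finset.Icc 1 N, z ^ k := by
    simp
  rw [h2] at h1
  have h3 := norm_sub_norm_le (N : ℂ) (∑ k ∈ Finset.Icc 1 N, z ^ k)
  rw [Complex.norm_natCast] at h3
  linarith

lemma half_le_norm_one_sub {z : ℂ} (hz : ‖z‖ ≤ 1) (hz1 : z ≠ 1) : 1 / 2 ≤ 1 / ‖1 - z‖ := by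
  have h0 : 0 < ‖1 - z‖ := norm_pos_iff.2 (sub_ne_zero.2 hz1.symm)
  refine one_div_le_one_div_of_le h0 ?_
  have := norm_sub_le (1 : ℂ) z
  rw [norm_one] at this
  linarith

namespace HalfRegular

variable {b : ℝ → ℝ} {V : ℝ}

/-- Since the weights decrease and `1 - Re z ^ n ≥ 0`, the real part of `1 - B(z)` is at least
`γ_N * ∑_{n ≤ N} (1 - Re z ^ n)`, and the sum is at least `N - 2 / |1 - z|`. -/
lemma tailSum_le_norm_one_sub_seriesB (h : HalfRegular b V) {z : ℂ} (hz : ‖z‖ ≤ 1) (hz1 : z ≠ 1)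
    {N : ℕ} (hN : 4 * (1 / ‖1 - z‖) ≤ N) :
    normConst b * tailSum b N / 2 ≤ ‖1 - seriesB b z‖ := by
  have h0 : 0 < ‖1 - z‖ := norm_pos_iff.2 (sub_ne_zero.2 hz1.symm)
  have hN1 : 1 ≤ N := by
    have : (0 : ℝ) < N := lt_of_lt_of_le (by positivity) hN
    exact_mod_cast this
  have hre : HasSum (fun n => gammaCoeff b n * (1 - (z ^ n).re)) (1 - seriesB b z).re := by
    have := Complex.hasSum_re (h.hasSum_one_sub_seriesB hz)
    simpa using this
  have hre1 : ∀ n : ℕ, 0 ≤ 1 - (z ^ n).re := fun n => by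
    have h1 := Complex.re_le_norm (z ^ n)
    rw [norm_pow] at h1
    linarith [pow_le_one₀ (n := n) (norm_nonneg z) hz]
  have hU : ‖∑ k ∈ Finset.Icc 1 N, z ^ k‖ ≤ N / 2 := by
    have h1 := norm_sum_pow_mul_le hz N
    rw [← le_div_iff₀ h0] at h1
    have : 2 / ‖1 - z‖ = (4 * (1 / ‖1 - z‖)) / 2 := by ring
    linarith
  calc normConst b * tailSum b N / 2 = gammaCoeff b N * (N / 2) := by
        rw [← nat_mul_gammaCoeff hN1]; ring
    _ ≤ gammaCoeff b N * ∑ k ∈ Finset.Icc 1 N, (1 - (z ^ k).re) := by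
        refine mul_le_mul_of_nonneg_left ?_ (h.gammaCoeff_nonneg N)
        rw [Finset.sum_sub_distrib, ← Complex.re_sum]
        have := Complex.re_le_norm (∑ k ∈ Finset.Icc 1 N, z ^ k)
        simp only [Finset.sum_const, Nat.card_Icc, nsmul_eq_mul, mul_one, Nat.add_sub_cancel]
        linarith
    _ ≤ ∑ k ∈ Finset.Icc 1 N, gammaCoeff b k * (1 - (z ^ k).re) := by
        rw [Finset.mul_sum]
        refine Finset.sum_le_sum fun k hk => mul_le_mul_of_nonneg_right ?_ (hre1 k)
        obtain ⟨hk1, hkN⟩ := Finset.mem_Icc.1 hk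
        have := h.gammaCoeff_succ_antitone (show k - 1 ≤ N - 1 by omega)
        simpa [Nat.sub_add_cancel hk1, Nat.sub_add_cancel hN1] using this
    _ ≤ (1 - seriesB b z).re :=
        sum_le_hasSum _ (fun k _ => mul_nonneg (h.gammaCoeff_nonneg k) (hre1 k)) hre
    _ ≤ ‖1 - seriesB b z‖ := Complex.re_le_norm _

lemma one_sub_seriesB_ne_zero (h : HalfRegular b V) {z : ℂ} (hz : ‖z‖ ≤ 1) (hz1 : z ≠ 1) :
    1 - seriesB b z ≠ 0 := by
  have h0 : 0 < ‖1 - z‖ := norm_pos_iff.2 (sub_ne_zero.2 hz1.symm)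
  have h1 := h.tailSum_le_norm_one_sub_seriesB hz hz1 (Nat.le_ceil _)
  have h2 := h.tailSum_pos (n := ⌈4 * (1 / ‖1 - z‖)⌉₊) (Nat.one_le_ceil_iff.2 (by positivity))
  have h3 := h.normConst_pos
  rw [← norm_pos_iff]
  exact lt_of_lt_of_le (by positivity) h1

/-- The upper bound for `1 - B`, from `|1 - z ^ n| ≤ min (n * |1 - z|) 2`. -/
lemma exists_norm_one_sub_seriesB_le (h : HalfRegular b V) :
    ∃ C > 0, ∀ z : ℂ, ‖z‖ ≤ 1 → z ≠ 1 → V ≤ 1 / ‖1 - z‖ →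
      ‖1 - seriesB b z‖ ≤ C * (1 / ‖1 - z‖ * tailTerm b (1 / ‖1 - z‖)) := by
  obtain ⟨κ, hκ, hκu⟩ := h.exists_le_sq_mul_tailTerm
  have hc := h.normConst_pos
  have ht1 := h.tailSum_pos le_rfl
  set M := ⌈V⌉₊ with hM
  refine ⟨normConst b * (M * tailSum b 1 / κ + 32 + 128), by positivity, fun z hz hz1 hV => ?_⟩
  have h0 : 0 < ‖1 - z‖ := norm_pos_iff.2 (sub_ne_zero.2 hz1.symm)
  set u := 1 / ‖1 - z‖ with hu
  have hu0 : 0 < u := by positivity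
  have hu1 : ‖1 - z‖ = u⁻¹ := by rw [hu]; simp
  set N := ⌈u⌉₊ with hN
  have huN : u ≤ N := Nat.le_ceil u
  have hNu : (N : ℝ) ≤ u + 1 := (Nat.ceil_lt_add_one hu0.le).le
  have hMN : M ≤ N := Nat.ceil_mono hV
  have hVM : V ≤ M := Nat.le_ceil V
  have hM1 : 1 ≤ M := by exact_mod_cast h.one_le.trans hVM
  have hx := h.tailTerm_pos (u := u) (by linarith [h.one_le])
  have hs := h.hasSum_one_sub_seriesB hz
  have hbase : ∀ n, ‖(gammaCoeff b n : ℂ) * (1 - z ^ n)‖ = gammaCoeff b n * ‖1 - z ^ n‖ := by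
    intro n
    rw [norm_mul, Complex.norm_real, Real.norm_of_nonneg (h.gammaCoeff_nonneg n)]
  have hle2 : ∀ n : ℕ, ‖1 - z ^ n‖ ≤ 2 := fun n => by
    calc _ ≤ ‖(1 : ℂ)‖ + ‖z ^ n‖ := norm_sub_le _ _
      _ ≤ 1 + 1 := by
        rw [norm_one, norm_pow]; gcongr; exact pow_le_one₀ (norm_nonneg _) hz
      _ = 2 := by norm_num
  have hfirst : ‖∑ n ∈ Finset.range N, (gammaCoeff b n : ℂ) * (1 - z ^ n)‖ ≤
      normConst b * (M * tailSum b 1 / κ + 32) * (u * tailTerm b u) := by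
    have hbd : ∀ n ∈ Finset.range N, ‖(gammaCoeff b n : ℂ) * (1 - z ^ n)‖ ≤
        normConst b * u⁻¹ * (if n = 0 then 0 else tailSum b n) := by
      intro n _
      rw [hbase]
      rcases Nat.eq_zero_or_pos n with rfl | hn
      · simp
      · rw [if_neg (by omega)]
        calc _ ≤ gammaCoeff b n * (n * ‖1 - z‖) :=
              mul_le_mul_of_nonneg_left (norm_one_sub_pow_le hz n) (h.gammaCoeff_nonneg n)
          _ = (n * gammaCoeff b n) * u⁻¹ := by rw [hu1]; ring
          _ = _ := by rw [nat_mul_gammaCoeff hn]; ring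
    refine (norm_sum_le_of_le _ hbd).trans ?_
    rw [← Finset.mul_sum, ← Finset.sum_range_add_sum_Ico _ hMN]
    have hA : ∑ n ∈ Finset.range M, (if n = 0 then 0 else tailSum b n) ≤ M * tailSum b 1 := by
      refine (Finset.sum_le_sum (g := fun _ => tailSum b 1) fun n _ => ?_).trans (by simp)
      split_ifs with hn
      · exact ht1.le
      · exact h.tailSum_antitone (by omega)
    have hB : ∑ n ∈ Finset.Ico M N, (if n = 0 then 0 else tailSum b n) ≤
        32 * (u * (u * tailTerm b u)) := by
      have h1 : ∑ n ∈ Finset.Ico M N, (if n = 0 then 0 else tailSum b n) ≤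
          ∑ n ∈ Finset.Ico M N, 8 * ((n : ℝ) * tailTerm b n) := by
        refine Finset.sum_le_sum fun n hn => ?_
        have hnM := (Finset.mem_Ico.1 hn).1
        rw [if_neg (by omega)]
        exact (h.tail_tailTerm (hVM.trans (by exact_mod_cast hnM)) le_rfl).2
      have h2 := sum_Ico_le_of_monotoneOn (g := fun v => v * tailTerm b v) (q := 3 / 4) h.one_le
        (by norm_num) (by norm_num)
        (fun v hv => mul_nonneg (by linarith [h.one_le])
          (h.tailTerm_pos (by linarith [h.one_le])).le)
        (by
          intro v hv w hw hvw
          have e : ∀ v ∈ Set.Ici V, v ^ (3 / 4 : ℝ) * (v * tailTerm b v) =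
              v ^ (7 / 4 : ℝ) * tailTerm b v := by
            intro v hv
            have hv0 : 0 < v := by linarith [h.one_le, Set.mem_Ici.1 hv]
            rw [← mul_assoc, ← Real.rpow_add_one hv0.ne']
            norm_num
          simp only [e v hv, e w hw]
          exact h.tailTerm_monotone hv hw hvw)
        hV hVM hNu
      rw [← Finset.mul_sum] at h1
      norm_num at h2
      linarith
    have hC : M * tailSum b 1 ≤ M * tailSum b 1 / κ * (u * (u * tailTerm b u)) := by
      have h1 := hκu u hV
      rw [div_mul_eq_mul_div, le_div_iff₀ hκ]
      refine mul_le_mul_of_nonneg_left ?_ (by positivity)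
      linarith
    calc _ ≤ normConst b * u⁻¹ *
          (M * tailSum b 1 / κ * (u * (u * tailTerm b u)) + 32 * (u * (u * tailTerm b u))) := by
          refine mul_le_mul_of_nonneg_left ?_ (by positivity)
          linarith
      _ = _ := by field_simp
  have hsecond : ‖∑' j : ℕ, (gammaCoeff b (j + N) : ℂ) * (1 - z ^ (j + N))‖ ≤
      normConst b * 128 * (u * tailTerm b u) := by
    obtain ⟨hs1, hs2⟩ := h.tail_tailTerm hV huN
    refine (tsum_of_norm_bounded (hs1.hasSum.mul_left (normConst b * 16)) fun j => ?_).trans ?_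
    · rw [hbase]
      have hVN : V ≤ ((j + N : ℕ) : ℝ) := by
        push_cast; linarith [j.cast_nonneg (α := ℝ)]
      have h1 := h.rawWeight_le_tailTerm hVN
      calc gammaCoeff b (j + N) * ‖1 - z ^ (j + N)‖ ≤ gammaCoeff b (j + N) * 2 :=
            mul_le_mul_of_nonneg_left (hle2 _) (h.gammaCoeff_nonneg _)
        _ ≤ normConst b * (8 * tailTerm b ((j + N : ℕ) : ℝ)) * 2 := by
            rw [gammaCoeff]; gcongr
        _ = _ := by rw [add_comm j N]; ring
    · have := mul_le_mul_of_nonneg_left hs2 (by positivity : 0 ≤ normConst b * 16)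
      rw [tailSum] at this
      linarith
  rw [← hs.tsum_eq, ← hs.summable.sum_add_tsum_nat_add N]
  calc _ ≤ _ := norm_add_le _ _
    _ ≤ _ := add_le_add hfirst hsecond
    _ = _ := by ring

end HalfRegular

/-! ### The Taylor coefficients of `A` -/

/-- The renewal sequence of the weights `γ_1, γ_2, …`. -/
noncomputable def renewalCoeff (b : ℝ → ℝ) (n : ℕ) : ℝ :=
  renewal (fun n => gammaCoeff b (n + 1)) n

/-- The partial sums of `∑ α_n z ^ n`. -/
noncomputable def partialA (b : ℝ → ℝ) (N : ℕ) (z : ℂ) : ℂ :=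
  ∑ n ∈ Finset.range N, (renewalCoeff b n : ℂ) * z ^ n

namespace HalfRegular

variable {b : ℝ → ℝ} {V : ℝ}

lemma renewalCoeff_nonneg (h : HalfRegular b V) (n : ℕ) : 0 ≤ renewalCoeff b n :=
  h.renewalWeights.renewal_nonneg n

lemma renewalCoeff_le_one (h : HalfRegular b V) (n : ℕ) : renewalCoeff b n ≤ 1 :=
  h.renewalWeights.renewal_le_one n

lemma norm_partialA_le (h : HalfRegular b V) {z : ℂ} (hz : ‖z‖ ≤ 1) (hz1 : z ≠ 1) (N : ℕ) :
    ‖partialA b N z‖ ≤ 2 * ‖funA b z‖ := by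
  have h0 := norm_pos_iff.2 (h.one_sub_seriesB_ne_zero hz hz1)
  have h1 := h.renewalWeights.norm_partial_sum_mul_le hz N
  rw [← seriesB_eq, norm_mul] at h1
  rwa [funA, norm_div, norm_one, mul_one_div, le_div_iff₀ h0]

lemma tendsto_partialA (h : HalfRegular b V) {z : ℂ} (hz : ‖z‖ ≤ 1) (hz1 : z ≠ 1) :
    Tendsto (fun N => partialA b N z) atTop (𝓝 (funA b z)) := by
  have h0 := h.one_sub_seriesB_ne_zero hz hz1
  have h1 := h.renewalWeights.tendsto_partial_sum_mul hz hz1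
  rw [← seriesB_eq] at h1
  have h2 := h1.div_const (1 - seriesB b z)
  simp only [mul_div_cancel_right₀ _ h0] at h2
  exact h2

lemma tendsto_norm_partialA_one (h : HalfRegular b V) :
    Tendsto (fun N => ‖partialA b N 1‖) atTop atTop := by
  refine h.renewalWeights.tendsto_sum_renewal.congr fun N => ?_
  have e : partialA b N 1 = ((∑ n ∈ Finset.range N, renewalCoeff b n : ℝ) : ℂ) := by
    simp [partialA]
  rw [e, Complex.norm_real, Real.norm_of_nonneg]
  · rfl
  · exact Finset.sum_nonneg fun n _ => h.renewalCoeff_nonneg n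

lemma hasFPowerSeriesOnBall_funA (h : HalfRegular b V) :
    HasFPowerSeriesOnBall (funA b)
      (FormalMultilinearSeries.ofScalars ℂ fun n => (renewalCoeff b n : ℂ)) 0 1 where
  r_le := by
    refine FormalMultilinearSeries.le_radius_of_bound _ 1 (r := 1) fun n => ?_
    rw [FormalMultilinearSeries.ofScalars_norm, Complex.norm_real,
      Real.norm_of_nonneg (h.renewalCoeff_nonneg n)]
    simpa using h.renewalCoeff_le_one n
  r_pos := one_pos
  hasSum := by
    intro y hy
    have hy1 : ‖y‖ < 1 := by
      rwa [Metric.mem_eball, edist_zero_right, ← ofReal_norm, ENNReal.ofReal_lt_one] at hy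
    have hy2 : y ≠ 1 := fun e => by rw [e, norm_one] at hy1; exact lt_irrefl _ hy1
    have hs : Summable fun n => (renewalCoeff b n : ℂ) * y ^ n := by
      refine Summable.of_norm_bounded (summable_geometric_of_lt_one (norm_nonneg y) hy1)
        fun n => ?_
      rw [norm_mul, norm_pow, Complex.norm_real,
        Real.norm_of_nonneg (h.renewalCoeff_nonneg n)]
      exact mul_le_of_le_one_left (by positivity) (h.renewalCoeff_le_one n)
    have h1 := hs.hasSum
    rw [tendsto_nhds_unique h1.tendsto_sum_nat (h.tendsto_partialA hy1.le hy2)] at h1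
    simpa [FormalMultilinearSeries.ofScalars_apply_eq, mul_comm] using h1

lemma alphaCoeff_eq (h : HalfRegular b V) (n : ℕ) : alphaCoeff b n = renewalCoeff b n := by
  have h1 := h.hasFPowerSeriesOnBall_funA.factorial_smul 1 n
  have h0 : (n.factorial : ℂ) ≠ 0 := by exact_mod_cast n.factorial_ne_zero
  rw [alphaCoeff, iteratedDeriv_eq_iteratedFDeriv, ← h1]
  simp [h0]

end HalfRegular

/-! ### Comparison of the three weights on the disk -/

/-- `|A(z)| ^ 2`, with the value `+∞` at `z = 1`. -/
noncomputable def normSqA (b : ℝ → ℝ) (z : ℂ) : ℝ≥0∞ :=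
  if z = 1 then ⊤ else ENNReal.ofReal (‖funA b z‖ ^ 2)

/-- `∑_{n ≥ 1} b(n) |z + ⋯ + z ^ n| ^ 2 / n ^ 2`. -/
noncomputable def powerWeight (b : ℝ → ℝ) (z : ℂ) : ℝ≥0∞ :=
  ∑' n : ℕ, ENNReal.ofReal (b ((n + 1 : ℕ) : ℝ) * ‖∑ k ∈ Finset.Icc 1 (n + 1), z ^ k‖ ^ 2 /
    ((n + 1 : ℕ) : ℝ) ^ 2)

/-- Affine domination on the closed disk, which transfers finiteness of integrals against finite
measures. -/
def DominatedOnDisk (X Y : ℂ → ℝ≥0∞) : Prop :=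
  ∃ C : ℝ, ∀ z : ℂ, ‖z‖ ≤ 1 → X z ≤ ENNReal.ofReal C * Y z + ENNReal.ofReal C

lemma DominatedOnDisk.lintegral_lt_top {X Y : ℂ → ℝ≥0∞} (h : DominatedOnDisk X Y)
    {μ : Measure ℂ} [IsFiniteMeasure μ]
    (hY : ∫⁻ z in Metric.closedBall (0 : ℂ) 1, Y z ∂μ < ⊤) :
    ∫⁻ z in Metric.closedBall (0 : ℂ) 1, X z ∂μ < ⊤ := by
  obtain ⟨C, hC⟩ := h
  calc ∫⁻ z in Metric.closedBall (0 : ℂ) 1, X z ∂μ ≤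
        ∫⁻ z in Metric.closedBall (0 : ℂ) 1, (ENNReal.ofReal C * Y z + ENNReal.ofReal C) ∂μ :=
        setLIntegral_mono' Metric.isClosed_closedBall.measurableSet fun z hz =>
          hC z (by simpa using hz)
    _ = ENNReal.ofReal C * ∫⁻ z in Metric.closedBall (0 : ℂ) 1, Y z ∂μ +
        ENNReal.ofReal C * μ (Metric.closedBall (0 : ℂ) 1) := by
        rw [lintegral_add_right _ measurable_const, lintegral_const_mul' _ _ ENNReal.ofReal_ne_top,
          setLIntegral_const]
    _ < ⊤ := ENNReal.add_lt_top.2 ⟨ENNReal.mul_lt_top ENNReal.ofReal_lt_top hY,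
        ENNReal.mul_lt_top ENNReal.ofReal_lt_top (measure_lt_top _ _)⟩

/-- Reduction of affine domination to an inequality between real numbers away from the
point `1`. -/
lemma DominatedOnDisk.of_real {X Y : ℂ → ℝ≥0∞} {x y : ℂ → ℝ} (hX : ∀ z ≠ 1, ‖z‖ ≤ 1 →
    X z ≤ ENNReal.ofReal (x z)) (hY : ∀ z ≠ 1, ‖z‖ ≤ 1 → ENNReal.ofReal (y z) ≤ Y z)
    (hY1 : Y 1 = ⊤) {C₁ C₂ : ℝ} (h1 : 0 ≤ C₁)
    (h : ∀ z ≠ 1, ‖z‖ ≤ 1 → x z ≤ C₁ * y z ∨ x z ≤ C₂) : DominatedOnDisk X Y := by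
  set C := max C₁ C₂ + 1 with hC
  have hC1 : C₁ ≤ C := by rw [hC]; linarith [le_max_left C₁ C₂]
  have hC2 : C₂ ≤ C := by rw [hC]; linarith [le_max_right C₁ C₂]
  have hC0 : 0 < C := by rw [hC]; linarith [le_max_left C₁ C₂]
  refine ⟨C, fun z hz => ?_⟩
  rcases eq_or_ne z 1 with rfl | hz1
  · rw [hY1, ENNReal.mul_top (by simpa using hC0)]
    simp
  rcases h z hz1 hz with h2 | h2
  · refine le_trans ?_ le_self_add
    calc X z ≤ ENNReal.ofReal (C₁ * y z) := (hX z hz1 hz).trans (ENNReal.ofReal_le_ofReal h2)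
      _ = ENNReal.ofReal C₁ * ENNReal.ofReal (y z) := ENNReal.ofReal_mul h1
      _ ≤ _ := mul_le_mul' (ENNReal.ofReal_le_ofReal hC1) (hY z hz1 hz)
  · exact (hX z hz1 hz).trans ((ENNReal.ofReal_le_ofReal (h2.trans hC2)).trans le_add_self)

lemma diskWeight_of_ne {b : ℝ → ℝ} {z : ℂ} (hz1 : z ≠ 1) :
    diskWeight b z = ENNReal.ofReal (1 / ‖1 - z‖ * b (1 / ‖1 - z‖)) := by
  rw [diskWeight, if_neg hz1, div_eq_mul_one_div, mul_comm]

namespace HalfRegular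

variable {b : ℝ → ℝ} {V : ℝ}

lemma exists_mul_le (h : HalfRegular b V) (hb : BddAbove (b '' Set.Icc (1 / 2) V)) :
    ∃ C, ∀ u, 1 / 2 ≤ u → u ≤ V → u * b u ≤ C := by
  obtain ⟨m, hm⟩ := hb
  refine ⟨V * m, fun u hu huV => ?_⟩
  have h1 : b u ≤ m := hm ⟨u, ⟨hu, huV⟩, rfl⟩
  have h2 := h.pos u hu
  exact mul_le_mul huV h1 h2.le (by linarith)

lemma diskWeight_dominated_normSqA (h : HalfRegular b V)
    (hb : BddAbove (b '' Set.Icc (1 / 2) V)) :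
    DominatedOnDisk (diskWeight b) (normSqA b) := by
  obtain ⟨C, hC0, hC⟩ := h.exists_norm_one_sub_seriesB_le
  obtain ⟨C₂, hC₂⟩ := h.exists_mul_le hb
  refine DominatedOnDisk.of_real (x := fun z => 1 / ‖1 - z‖ * b (1 / ‖1 - z‖))
    (y := fun z => ‖funA b z‖ ^ 2) (C₁ := C ^ 2) (C₂ := C₂)
    (fun z hz1 _ => (diskWeight_of_ne hz1).le) (fun z hz1 _ => by rw [normSqA, if_neg hz1])
    (by rw [normSqA, if_pos rfl]) (by positivity) fun z hz1 hz => ?_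
  set u := 1 / ‖1 - z‖ with hu
  have hu2 : 1 / 2 ≤ u := half_le_norm_one_sub hz hz1
  rcases le_total V u with hV | hV
  · left
    have h1 := hC z hz hz1 hV
    have h0 := norm_pos_iff.2 (h.one_sub_seriesB_ne_zero hz hz1)
    have h2 : ‖1 - seriesB b z‖ ^ 2 ≤ (C * (u * tailTerm b u)) ^ 2 :=
      pow_le_pow_left₀ h0.le h1 2
    rw [mul_pow, h.sq_mul_tailTerm hu2, mul_one_div] at h2
    have hub : 0 < u * b u := mul_pos (by linarith) (h.pos u hu2)
    rw [le_div_iff₀ hub] at h2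
    rw [funA, norm_div, norm_one, div_pow, one_pow, mul_one_div, le_div_iff₀ (by positivity)]
    linarith
  · exact Or.inr (hC₂ u hu2 hV)

lemma normSqA_dominated_diskWeight (h : HalfRegular b V) :
    DominatedOnDisk (normSqA b) (diskWeight b) := by
  have hc := h.normConst_pos
  set K := ⌈4 * V⌉₊ with hK
  have hK1 : 1 ≤ K := Nat.one_le_ceil_iff.2 (by linarith [h.one_le])
  have htK := h.tailSum_pos hK1
  refine DominatedOnDisk.of_real (y := fun z => 1 / ‖1 - z‖ * b (1 / ‖1 - z‖))
    (x := fun z => ‖funA b z‖ ^ 2) (C₁ := (200 / normConst b) ^ 2)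
    (C₂ := (2 / (normConst b * tailSum b K)) ^ 2)
    (fun z hz1 _ => by rw [normSqA, if_neg hz1]) (fun z hz1 _ => (diskWeight_of_ne hz1).ge)
    (by rw [diskWeight, if_pos rfl]) (by positivity) fun z hz1 hz => ?_
  set u := 1 / ‖1 - z‖ with hu
  have hu2 : 1 / 2 ≤ u := half_le_norm_one_sub hz hz1
  have h0 := norm_pos_iff.2 (h.one_sub_seriesB_ne_zero hz hz1)
  rw [funA, norm_div, norm_one]
  rcases le_total V u with hV | hV
  · left
    have hN : 4 * u ≤ (⌈4 * u⌉₊ : ℕ) := Nat.le_ceil _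
    have hN2 : ((⌈4 * u⌉₊ : ℕ) : ℝ) ≤ 4 * u + 1 :=
      (Nat.ceil_lt_add_one (by linarith)).le
    have h1 := h.tailSum_le_norm_one_sub_seriesB hz hz1 hN
    have h2 := h.le_tailSum hV (N := ⌈4 * u⌉₊) (by linarith) (by linarith [h.one_le])
    have hx := h.tailTerm_pos hu2
    have hux : 0 < u * tailTerm b u := mul_pos (by linarith) hx
    have h3 : normConst b / 200 * (u * tailTerm b u) ≤ ‖1 - seriesB b z‖ := by
      nlinarith [mul_le_mul_of_nonneg_left h2 hc.le]
    have h4 : (normConst b / 200 * (u * tailTerm b u)) ^ 2 ≤ ‖1 - seriesB b z‖ ^ 2 :=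
      pow_le_pow_left₀ (by positivity) h3 2
    have hub : 0 < u * b u := mul_pos (by linarith) (h.pos u hu2)
    rw [mul_pow, h.sq_mul_tailTerm hu2] at h4
    rw [div_pow, one_pow]
    calc 1 / ‖1 - seriesB b z‖ ^ 2 ≤ 1 / ((normConst b / 200) ^ 2 * (1 / (u * b u))) :=
          one_div_le_one_div_of_le (by positivity) h4
      _ = _ := by field_simp
  · right
    have h1 := h.tailSum_le_norm_one_sub_seriesB hz hz1 (N := K)
      ((by linarith : 4 * u ≤ 4 * V).trans (Nat.le_ceil _))
    refine pow_le_pow_left₀ (by positivity) ?_ 2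
    calc 1 / ‖1 - seriesB b z‖ ≤ 1 / (normConst b * tailSum b K / 2) :=
          one_div_le_one_div_of_le (by positivity) h1
      _ = _ := by field_simp

lemma antitoneOn_div_sq (h : HalfRegular b V) :
    AntitoneOn (fun u : ℝ => u ^ (3 / 2 : ℝ) * (b u / u ^ 2)) (Set.Ici V) := by
  have e : ∀ u ∈ Set.Ici V, u ^ (3 / 2 : ℝ) * (b u / u ^ 2) = u ^ (-(1 / 2) : ℝ) * b u := by
    intro u hu
    have hu0 : 0 < u := by linarith [h.one_le, Set.mem_Ici.1 hu]
    have : u ^ (3 / 2 : ℝ) = u ^ (-(1 / 2) : ℝ) * u ^ 2 := by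
      rw [← Real.rpow_natCast u 2, ← Real.rpow_add hu0]; norm_num
    rw [this]
    field_simp
  intro u hu v hv huv
  simp only [e u hu, e v hv]
  exact h.anti hu hv huv

lemma div_sq_nonneg (h : HalfRegular b V) {u : ℝ} (hu : 1 / 2 ≤ u) : 0 ≤ b u / u ^ 2 :=
  div_nonneg (h.pos u hu).le (sq_nonneg u)

lemma summable_div_sq (h : HalfRegular b V) : Summable fun n : ℕ => b n / (n : ℝ) ^ 2 := by
  have h1 := (tail_le_of_antitoneOn h.one_le (by norm_num) (by norm_num)
    (fun u hu => h.div_sq_nonneg (by linarith [h.one_le])) h.antitoneOn_div_sq le_rfl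
    (Nat.le_ceil V)).1
  refine (summable_nat_add_iff ⌈V⌉₊).1 ?_
  simpa [add_comm] using h1

lemma powerTerm_nonneg (h : HalfRegular b V) (z : ℂ) (n : ℕ) :
    0 ≤ b n * ‖∑ k ∈ Finset.Icc 1 n, z ^ k‖ ^ 2 / (n : ℝ) ^ 2 := by
  rcases Nat.eq_zero_or_pos n with rfl | hn
  · simp
  · have : (1 : ℝ) ≤ n := by exact_mod_cast hn
    have := h.pos n (by linarith)
    positivity

lemma powerTerm_le (h : HalfRegular b V) {z : ℂ} (hz : ‖z‖ ≤ 1) {n : ℕ} (hn : 1 ≤ n) :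
    b n * ‖∑ k ∈ Finset.Icc 1 n, z ^ k‖ ^ 2 / (n : ℝ) ^ 2 ≤ b n := by
  have hn1 : (1 : ℝ) ≤ n := by exact_mod_cast hn
  have hb := h.pos n (by linarith)
  rw [div_le_iff₀ (by positivity)]
  refine mul_le_mul_of_nonneg_left ?_ hb.le
  exact pow_le_pow_left₀ (norm_nonneg _) (norm_sum_pow_le_natCast hz n) 2

lemma powerTerm_le_div_sq (h : HalfRegular b V) {z : ℂ} (hz : ‖z‖ ≤ 1) (hz1 : z ≠ 1) (n : ℕ) :
    b n * ‖∑ k ∈ Finset.Icc 1 n, z ^ k‖ ^ 2 / (n : ℝ) ^ 2 ≤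
      4 * (1 / ‖1 - z‖) ^ 2 * (b n / (n : ℝ) ^ 2) := by
  rcases Nat.eq_zero_or_pos n with rfl | hn
  · simp
  have hn1 : (1 : ℝ) ≤ n := by exact_mod_cast hn
  have hb := h.pos n (by linarith)
  have h0 : 0 < ‖1 - z‖ := norm_pos_iff.2 (sub_ne_zero.2 hz1.symm)
  have h1 : ‖∑ k ∈ Finset.Icc 1 n, z ^ k‖ ≤ 2 * (1 / ‖1 - z‖) := by
    rw [mul_one_div, le_div_iff₀ h0]
    exact norm_sum_pow_mul_le hz n
  have h2 := pow_le_pow_left₀ (norm_nonneg _) h1 2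
  rw [mul_div_right_comm, mul_comm (b n / (n : ℝ) ^ 2)]
  refine mul_le_mul_of_nonneg_right ?_ (by positivity)
  linarith

lemma summable_powerTerm (h : HalfRegular b V) {z : ℂ} (hz : ‖z‖ ≤ 1) (hz1 : z ≠ 1) :
    Summable fun n : ℕ => b n * ‖∑ k ∈ Finset.Icc 1 n, z ^ k‖ ^ 2 / (n : ℝ) ^ 2 :=
  Summable.of_nonneg_of_le (h.powerTerm_nonneg z) (h.powerTerm_le_div_sq hz hz1)
    (h.summable_div_sq.mul_left _)

lemma powerWeight_eq (h : HalfRegular b V) {z : ℂ} (hz : ‖z‖ ≤ 1) (hz1 : z ≠ 1) :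
    powerWeight b z = ENNReal.ofReal
      (∑' n : ℕ, b n * ‖∑ k ∈ Finset.Icc 1 n, z ^ k‖ ^ 2 / (n : ℝ) ^ 2) := by
  have hs := h.summable_powerTerm hz hz1
  rw [powerWeight, hs.tsum_eq_zero_add, ENNReal.ofReal_add (h.powerTerm_nonneg z 0)
    (tsum_nonneg fun n => h.powerTerm_nonneg z (n + 1)),
    ENNReal.ofReal_tsum_of_nonneg (fun n => h.powerTerm_nonneg z (n + 1))
      ((summable_nat_add_iff 1).2 hs)]
  simp

/-- At `z = 1` the terms are `b(n)`, which is at least a multiple of `1 / n`. -/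
lemma powerWeight_one (h : HalfRegular b V) : powerWeight b 1 = ⊤ := by
  have e : powerWeight b 1 = ∑' n : ℕ, ENNReal.ofReal (b ((n + 1 : ℕ) : ℝ)) := by
    rw [powerWeight]
    congr 1
    ext n
    congr 1
    have : ((n + 1 : ℕ) : ℝ) ≠ 0 := by positivity
    simp only [one_pow, Finset.sum_const, Nat.card_Icc, Nat.add_sub_cancel, nsmul_eq_mul, mul_one,
      Complex.norm_natCast]
    field_simp
  have hpos : ∀ n : ℕ, 0 ≤ b ((n + 1 : ℕ) : ℝ) := fun n => (h.pos _ (by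
    push_cast; linarith [n.cast_nonneg (α := ℝ)])).le
  by_contra hne
  rw [e] at hne
  have hs : Summable fun n : ℕ => b ((n + 1 : ℕ) : ℝ) := by
    have := ENNReal.summable_toReal hne
    simpa only [ENNReal.toReal_ofReal (hpos _)] using this
  have hV0 : 0 < V := by linarith [h.one_le]
  set κ := V ^ (1 / 2 : ℝ) * b V with hκ
  have hκ0 : 0 < κ := mul_pos (Real.rpow_pos_of_pos hV0 _) (h.pos_of_le le_rfl)
  have hle : ∀ u, V ≤ u → κ * (1 / u) ≤ b u := by
    intro u hu
    have hu0 : 0 < u := by linarith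
    have h1 := h.mono (Set.mem_Ici.2 le_rfl) (Set.mem_Ici.2 hu) hu
    simp only at h1
    have h2 : u ^ (1 / 2 : ℝ) ≤ u := by
      simpa using Real.rpow_le_rpow_of_exponent_le (h.one_le.trans hu)
        (by norm_num : (1 / 2 : ℝ) ≤ 1)
    rw [mul_one_div, div_le_iff₀ hu0]
    nlinarith [h.pos_of_le hu]
  have h1 : Summable fun n : ℕ => κ * (1 / (n : ℝ)) := by
    refine (summable_nat_add_iff (⌈V⌉₊ + 1)).1 ?_
    refine Summable.of_nonneg_of_le (fun n => by positivity) (fun n => hle _ ?_)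
      ((summable_nat_add_iff ⌈V⌉₊).2 hs)
    push_cast
    linarith [Nat.le_ceil V, n.cast_nonneg (α := ℝ)]
  exact Real.not_summable_one_div_natCast ((summable_mul_left_iff hκ0.ne').1 h1)

lemma powerWeight_dominated_diskWeight (h : HalfRegular b V) :
    DominatedOnDisk (powerWeight b) (diskWeight b) := by
  set M := ⌈V⌉₊ with hM
  have hVM : V ≤ M := Nat.le_ceil V
  have hV0 : 0 < V := by linarith [h.one_le]
  have hV1 := h.one_le
  set S := ∑' n : ℕ, b n / (n : ℝ) ^ 2 with hS
  set B := ∑ n ∈ Finset.range M, |b n| with hB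
  -- The terms with `n < M` contribute at most `B`, a multiple `B / κ` of `u * b u`.
  set κ := V ^ (1 / 2 : ℝ) * b V with hκ
  have hκ0 : 0 < κ := mul_pos (Real.rpow_pos_of_pos hV0 _) (h.pos_of_le le_rfl)
  have hB0 : 0 ≤ B := Finset.sum_nonneg fun _ _ => abs_nonneg _
  refine DominatedOnDisk.of_real (y := fun z => 1 / ‖1 - z‖ * b (1 / ‖1 - z‖))
    (x := fun z => ∑' n : ℕ, b n * ‖∑ k ∈ Finset.Icc 1 n, z ^ k‖ ^ 2 / (n : ℝ) ^ 2)
    (C₁ := B / κ + 2 + 16) (C₂ := 4 * V ^ 2 * S)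
    (fun z hz1 hz => (h.powerWeight_eq hz hz1).le) (fun z hz1 _ => (diskWeight_of_ne hz1).ge)
    (by rw [diskWeight, if_pos rfl]) (by positivity) fun z hz1 hz => ?_
  set u := 1 / ‖1 - z‖ with hu
  have hu2 : 1 / 2 ≤ u := half_le_norm_one_sub hz hz1
  have hs := h.summable_powerTerm hz hz1
  have hsum := h.summable_div_sq
  rcases le_total V u with hV | hV
  · left
    have hu0 : 0 < u := by linarith
    set N := ⌈u⌉₊ with hN
    have huN : u ≤ N := Nat.le_ceil u
    have hNu : (N : ℝ) ≤ u + 1 := (Nat.ceil_lt_add_one hu0.le).le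
    have hMN : M ≤ N := Nat.ceil_mono hV
    have hbu := h.pos_of_le hV
    rw [← hs.sum_add_tsum_nat_add N, ← Finset.sum_range_add_sum_Ico _ hMN]
    have hA : ∑ n ∈ Finset.range M, b n * ‖∑ k ∈ Finset.Icc 1 n, z ^ k‖ ^ 2 / (n : ℝ) ^ 2 ≤
        B / κ * (u * b u) := by
      have h1 : ∑ n ∈ Finset.range M, b n * ‖∑ k ∈ Finset.Icc 1 n, z ^ k‖ ^ 2 / (n : ℝ) ^ 2 ≤
          B := by
        refine Finset.sum_le_sum fun n _ => ?_
        rcases Nat.eq_zero_or_pos n with rfl | hn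
        · simp
        · exact (h.powerTerm_le hz hn).trans (le_abs_self _)
      refine h1.trans ?_
      rw [div_mul_eq_mul_div, le_div_iff₀ hκ0]
      refine mul_le_mul_of_nonneg_left ?_ hB0
      refine (h.mono (Set.mem_Ici.2 le_rfl) (Set.mem_Ici.2 hV) hV).trans ?_
      refine mul_le_mul_of_nonneg_right ?_ hbu.le
      simpa using Real.rpow_le_rpow_of_exponent_le (hV1.trans hV)
        (by norm_num : (1 / 2 : ℝ) ≤ 1)
    have hB' : ∑ n ∈ Finset.Ico M N, b n * ‖∑ k ∈ Finset.Icc 1 n, z ^ k‖ ^ 2 / (n : ℝ) ^ 2 ≤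
        2 * (u * b u) := by
      have h1 := sum_Ico_le_of_monotoneOn hV1 (by norm_num) (by norm_num)
        (fun v hv => (h.pos_of_le hv).le) h.mono hV hVM hNu
      norm_num at h1
      refine le_trans (Finset.sum_le_sum fun n hn => h.powerTerm_le hz ?_) h1
      have := (Finset.mem_Ico.1 hn).1
      have hM1 : 1 ≤ M := by exact_mod_cast hV1.trans hVM
      omega
    have hC : ∑' j : ℕ, b ((j + N : ℕ) : ℝ) * ‖∑ k ∈ Finset.Icc 1 (j + N), z ^ k‖ ^ 2 /
        ((j + N : ℕ) : ℝ) ^ 2 ≤ 16 * (u * b u) := by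
      obtain ⟨h1, h2⟩ := tail_le_of_antitoneOn h.one_le (by norm_num) (by norm_num)
        (fun u hu => h.div_sq_nonneg (by linarith [h.one_le])) h.antitoneOn_div_sq hV huN
      have h3 : ∑' j : ℕ, b ((j + N : ℕ) : ℝ) * ‖∑ k ∈ Finset.Icc 1 (j + N), z ^ k‖ ^ 2 /
          ((j + N : ℕ) : ℝ) ^ 2 ≤
          ∑' j : ℕ, 4 * u ^ 2 * (b ((N + j : ℕ) : ℝ) / ((N + j : ℕ) : ℝ) ^ 2) := by
        refine ((summable_nat_add_iff N).2 hs).tsum_le_tsum (fun j => ?_) (h1.mul_left _)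
        rw [add_comm N j]
        exact h.powerTerm_le_div_sq hz hz1 (j + N)
      rw [tsum_mul_left] at h3
      have h4 := mul_le_mul_of_nonneg_left h2 (by positivity : 0 ≤ 4 * u ^ 2)
      have e : 4 * u ^ 2 * (2 / (3 / 2 - 1) * (u * (b u / u ^ 2))) = 16 * (u * b u) := by
        field_simp; norm_num
      linarith
    linarith
  · right
    calc _ ≤ ∑' n : ℕ, 4 * u ^ 2 * (b n / (n : ℝ) ^ 2) :=
          hs.tsum_le_tsum (h.powerTerm_le_div_sq hz hz1) (hsum.mul_left _)
      _ = 4 * u ^ 2 * S := tsum_mul_left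
      _ ≤ 4 * V ^ 2 * S := by
          have hS0 : 0 ≤ S := tsum_nonneg fun n => by
            rcases Nat.eq_zero_or_pos n with rfl | hn
            · simp
            · have : (1 : ℝ) ≤ n := by exact_mod_cast hn
              exact h.div_sq_nonneg (by linarith)
          have hu0 : 0 ≤ u := by linarith
          gcongr

/-- For `u = 1 / |1 - z|` large, the block of indices `u / 8 ≤ n ≤ u / 2`, where
`|z + ⋯ + z ^ n| ≥ n / 2`, already contributes a multiple of `u * b(u)`. -/
lemma diskWeight_dominated_powerWeight (h : HalfRegular b V)
    (hb : ∀ R : ℝ, BddAbove (b '' Set.Icc (1 / 2) R)) :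
    DominatedOnDisk (diskWeight b) (powerWeight b) := by
  have hV1 := h.one_le
  obtain ⟨m, hm⟩ := hb (8 * V)
  refine DominatedOnDisk.of_real (x := fun z => 1 / ‖1 - z‖ * b (1 / ‖1 - z‖))
    (y := fun z => ∑' n : ℕ, b n * ‖∑ k ∈ Finset.Icc 1 n, z ^ k‖ ^ 2 / (n : ℝ) ^ 2)
    (C₁ := 96) (C₂ := 8 * V * m)
    (fun z hz1 _ => (diskWeight_of_ne hz1).le) (fun z hz1 hz => (h.powerWeight_eq hz hz1).ge)
    h.powerWeight_one (by norm_num) fun z hz1 hz => ?_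
  have h0 : 0 < ‖1 - z‖ := norm_pos_iff.2 (sub_ne_zero.2 hz1.symm)
  set u := 1 / ‖1 - z‖ with hu
  have hu2 : 1 / 2 ≤ u := half_le_norm_one_sub hz hz1
  have hs := h.summable_powerTerm hz hz1
  rcases le_total (8 * V) u with hV | hV
  · left
    have hu0 : 0 < u := by linarith
    have huz : u * ‖1 - z‖ = 1 := by rw [hu]; field_simp
    set N := ⌊u / 4⌋₊ with hN
    have hNu : (N : ℝ) ≤ u / 4 := Nat.floor_le (by linarith)
    have huN : u / 8 ≤ N := by
      have := Nat.lt_floor_add_one (u / 4)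
      rw [← hN] at this
      linarith
    have hbu := h.pos u hu2
    have hterm : ∀ n ∈ Finset.Ico N (N + N), b u / 12 ≤
        b n * ‖∑ k ∈ Finset.Icc 1 n, z ^ k‖ ^ 2 / (n : ℝ) ^ 2 := by
      intro n hn
      obtain ⟨hn1, hn2⟩ := Finset.mem_Ico.1 hn
      have hn1' : (N : ℝ) ≤ n := by exact_mod_cast hn1
      have hn2' : (n : ℝ) ≤ N + N := by exact_mod_cast hn2.le
      have hnV : V ≤ n := by linarith
      have hn0 : (0 : ℝ) < n := by linarith
      have hnu : (n : ℝ) ≤ u := by linarith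
      have h1 : (n : ℝ) / 2 ≤ ‖∑ k ∈ Finset.Icc 1 n, z ^ k‖ :=
        half_le_norm_sum_pow hz (by nlinarith)
      have hbn := h.pos_of_le hnV
      have h2 : b u ≤ 3 * b n := by
        have h3 := h.anti (Set.mem_Ici.2 hnV) (Set.mem_Ici.2 (hnV.trans hnu)) hnu
        simp only [Real.rpow_neg hn0.le, Real.rpow_neg hu0.le, ← Real.sqrt_eq_rpow] at h3
        have hsn : 0 < Real.sqrt n := Real.sqrt_pos.2 hn0
        have hsu : 0 < Real.sqrt u := Real.sqrt_pos.2 hu0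
        have h4 : Real.sqrt u ≤ 3 * Real.sqrt n := by
          rw [show (3 : ℝ) * Real.sqrt n = Real.sqrt (9 * n) by
            rw [Real.sqrt_mul (by norm_num), show (9 : ℝ) = 3 ^ 2 by norm_num,
              Real.sqrt_sq (by norm_num)]]
          exact Real.sqrt_le_sqrt (by linarith)
        have h5 : b u * Real.sqrt n ≤ b n * Real.sqrt u := by
          have := mul_le_mul_of_nonneg_left h3 (mul_pos hsn hsu).le
          have e1 : Real.sqrt n * Real.sqrt u * ((Real.sqrt u)⁻¹ * b u) = b u * Real.sqrt n := by
            field_simp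
          have e2 : Real.sqrt n * Real.sqrt u * ((Real.sqrt n)⁻¹ * b n) = b n * Real.sqrt u := by
            field_simp
          linarith
        have h6 : b u * Real.sqrt n ≤ 3 * b n * Real.sqrt n := by
          nlinarith [mul_le_mul_of_nonneg_left h4 hbn.le]
        exact le_of_mul_le_mul_right h6 hsn
      rw [le_div_iff₀ (by positivity)]
      have h7 : ((n : ℝ) / 2) ^ 2 ≤ ‖∑ k ∈ Finset.Icc 1 n, z ^ k‖ ^ 2 :=
        pow_le_pow_left₀ (by positivity) h1 2
      nlinarith [mul_le_mul_of_nonneg_left h7 hbn.le,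
        mul_le_mul_of_nonneg_right h2 (sq_nonneg (n : ℝ))]
    have h8 : (N : ℝ) * (b u / 12) ≤
        ∑' n : ℕ, b n * ‖∑ k ∈ Finset.Icc 1 n, z ^ k‖ ^ 2 / (n : ℝ) ^ 2 := by
      calc (N : ℝ) * (b u / 12) = ∑ n ∈ Finset.Ico N (N + N), b u / 12 := by simp
        _ ≤ _ := Finset.sum_le_sum hterm
        _ ≤ _ := hs.sum_le_tsum _ fun n _ => h.powerTerm_nonneg z n
    have h9 := mul_le_mul_of_nonneg_right huN (by positivity : 0 ≤ b u / 12)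
    linarith
  · right
    have h1 : b u ≤ m := hm ⟨u, ⟨hu2, hV⟩, rfl⟩
    exact mul_le_mul hV h1 (h.pos u hu2).le (by linarith)

end HalfRegular

/-! ### Spectral measures and their moments -/

section Moments

variable {H : Type*} [NormedAddCommGroup H] [InnerProductSpace ℂ H] {T : H →L[ℂ] H} {f : H}

lemma integrableOn_closedBall_of_continuous {E : Type*} [NormedAddCommGroup E] {μ : Measure ℂ}
    [IsFiniteMeasure μ] {g : ℂ → E} (hg : Continuous g) :
    IntegrableOn g (Metric.closedBall (0 : ℂ) 1) μ :=
  hg.continuousOn.integrableOn_compact (isCompact_closedBall 0 1)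

/-- The mixed moments of a spectral measure, by polarization. -/
lemma IsSpectralMeasure.moment {μ : Measure ℂ} (hμ : IsSpectralMeasure T f μ) (n m : ℕ) :
    ∫ z in Metric.closedBall (0 : ℂ) 1, star (z ^ n) * z ^ m ∂μ =
      inner ℂ ((T ^ n) f) ((T ^ m) f) := by
  have := hμ.finite
  have key : ∀ c : ℂ, ‖(T ^ n) f + c • (T ^ m) f‖ ^ 2 =
      ∫ z in Metric.closedBall (0 : ℂ) 1, ‖z ^ n + c • z ^ m‖ ^ 2 ∂μ := by
    intro c
    have h1 := hμ.norm_sq (max n m)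
      fun k => (if k = n then 1 else 0) + c * (if k = m then 1 else 0)
    have hn : n < max n m + 1 := by omega
    have hm : m < max n m + 1 := by omega
    simpa [add_smul, add_mul, mul_smul, Finset.sum_add_distrib, hn, hm] using h1
  have hc : ∀ c : ℂ, IntegrableOn (fun z : ℂ => ((‖z ^ n + c • z ^ m‖ : ℂ)) ^ 2)
      (Metric.closedBall (0 : ℂ) 1) μ := fun c =>
    integrableOn_closedBall_of_continuous (by fun_prop)
  have key2 : ∀ c : ℂ, ((‖(T ^ n) f + c • (T ^ m) f‖ : ℂ)) ^ 2 =
      ∫ z in Metric.closedBall (0 : ℂ) 1, ((‖z ^ n + c • z ^ m‖ : ℂ)) ^ 2 ∂μ := by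
    intro c
    have := congrArg (fun x : ℝ => (x : ℂ)) (key c)
    simp only [← integral_complex_ofReal] at this
    exact_mod_cast this
  have e1 : ∀ z : ℂ, star (z ^ n) * z ^ m = ((‖z ^ n + (1 : ℂ) • z ^ m‖ : ℂ) ^ 2 -
      (‖z ^ n + (-1 : ℂ) • z ^ m‖ : ℂ) ^ 2 + ((‖z ^ n + (-Complex.I) • z ^ m‖ : ℂ) ^ 2 -
        (‖z ^ n + Complex.I • z ^ m‖ : ℂ) ^ 2) * Complex.I) / 4 := by
    intro z
    have := inner_eq_sum_norm_sq_div_four (𝕜 := ℂ) (z ^ n) (z ^ m)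
    rw [RCLike.inner_apply, mul_comm] at this
    rw [one_smul, neg_one_smul, neg_smul, ← sub_eq_add_neg, ← sub_eq_add_neg]
    exact this
  have e2 := inner_eq_sum_norm_sq_div_four (𝕜 := ℂ) ((T ^ n) f) ((T ^ m) f)
  have e3 : inner ℂ ((T ^ n) f) ((T ^ m) f) = ((‖(T ^ n) f + (1 : ℂ) • (T ^ m) f‖ : ℂ) ^ 2 -
      (‖(T ^ n) f + (-1 : ℂ) • (T ^ m) f‖ : ℂ) ^ 2 +
        ((‖(T ^ n) f + (-Complex.I) • (T ^ m) f‖ : ℂ) ^ 2 -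
        (‖(T ^ n) f + Complex.I • (T ^ m) f‖ : ℂ) ^ 2) * Complex.I) / 4 := by
    rw [one_smul, neg_one_smul, neg_smul, ← sub_eq_add_neg, ← sub_eq_add_neg]
    exact e2
  simp only [e1]
  rw [e3, key2, key2, key2, key2, integral_div, integral_add, integral_sub, integral_mul_const,
    integral_sub]
  all_goals first
    | exact hc _
    | exact (hc _).sub (hc _)
    | exact ((hc _).sub (hc _)).mul_const _

/-- A measure with the right mixed moments, pushed forward to the disk, is a spectral measure. -/
lemma isSpectralMeasure_map {X : Type*} [TopologicalSpace X] [MeasurableSpace X] [BorelSpace X]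
    [CompactSpace X]
    (ν : Measure X) [IsFiniteMeasure ν] {φ : X → ℂ} (hφ : Continuous φ) (hle : ∀ x, ‖φ x‖ ≤ 1)
    (hm : ∀ n m : ℕ, ∫ x, star (φ x ^ n) * φ x ^ m ∂ν = inner ℂ ((T ^ n) f) ((T ^ m) f)) :
    IsSpectralMeasure T f (ν.map φ) where
  finite := inferInstance
  compl_disk := by
    rw [Measure.map_apply hφ.measurable Metric.isClosed_closedBall.measurableSet.compl]
    convert measure_empty (μ := ν)
    ext x
    simpa using hle x
  norm_sq n a := by
    have hpre : φ ⁻¹' Metric.closedBall (0 : ℂ) 1 = Set.univ := by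
      ext x
      simpa using hle x
    rw [Measure.restrict_map hφ.measurable Metric.isClosed_closedBall.measurableSet, hpre,
      Measure.restrict_univ, integral_map hφ.aemeasurable
        (Continuous.aestronglyMeasurable (by fun_prop))]
    have hint : ∀ k l : ℕ, Integrable (fun x => star (φ x ^ k) * φ x ^ l) ν := fun k l =>
      (by fun_prop : Continuous fun x => star (φ x ^ k) * φ x ^ l).integrable_of_hasCompactSupport
        (HasCompactSupport.of_compactSpace _)
    rw [← Complex.ofReal_inj, ← integral_complex_ofReal]
    have e1 : ∀ x, ((‖∑ k ∈ Finset.range (n + 1), a k * φ x ^ k‖ ^ 2 : ℝ) : ℂ) =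
        ∑ k ∈ Finset.range (n + 1), ∑ l ∈ Finset.range (n + 1),
          (star (a k) * a l) * (star (φ x ^ k) * φ x ^ l) := by
      intro x
      rw [Complex.ofReal_pow, ← Complex.conj_mul', map_sum, Finset.sum_mul_sum]
      refine Finset.sum_congr rfl fun k _ => Finset.sum_congr rfl fun l _ => ?_
      rw [map_mul, starRingEnd_apply, starRingEnd_apply]
      ring
    have e2 : ((‖∑ k ∈ Finset.range (n + 1), a k • (T ^ k) f‖ ^ 2 : ℝ) : ℂ) =
        ∑ k ∈ Finset.range (n + 1), ∑ l ∈ Finset.range (n + 1),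
          (star (a k) * a l) * inner ℂ ((T ^ k) f) ((T ^ l) f) := by
      rw [Complex.ofReal_pow]
      have := inner_self_eq_norm_sq_to_K (𝕜 := ℂ) (∑ k ∈ Finset.range (n + 1), a k • (T ^ k) f)
      refine this.symm.trans ?_
      rw [sum_inner]
      refine Finset.sum_congr rfl fun k _ => ?_
      rw [inner_sum]
      refine Finset.sum_congr rfl fun l _ => ?_
      rw [inner_smul_left, inner_smul_right, starRingEnd_apply]
      ring
    simp only [e1]
    rw [e2, integral_finsetSum _ fun k _ => integrable_finsetSum _ fun l _ =>
      (hint k l).const_mul _]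
    refine Finset.sum_congr rfl fun k _ => ?_
    rw [integral_finsetSum _ fun l _ => (hint k l).const_mul _]
    refine Finset.sum_congr rfl fun l _ => ?_
    rw [integral_const_mul, hm]

/-- The moments determine the measure, by the Stone–Weierstrass theorem on the disk. -/
lemma IsSpectralMeasure.unique {μ ν : Measure ℂ} (hμ : IsSpectralMeasure T f μ)
    (hν : IsSpectralMeasure T f ν) : μ = ν := by
  have := hμ.finite
  have := hν.finite
  set K := Metric.closedBall (0 : ℂ) 1 with hK
  have hKm : MeasurableSet K := Metric.isClosed_closedBall.measurableSet
  have : CompactSpace K := isCompact_iff_compactSpace.1 (isCompact_closedBall (0 : ℂ) 1)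
  have : PolishSpace K := (Metric.isClosed_closedBall (x := (0 : ℂ)) (ε := 1)).polishSpace
  have : IsFiniteMeasure (μ.comap ((↑) : K → ℂ)) :=
    ⟨by rw [(MeasurableEmbedding.subtype_coe hKm).comap_apply]; exact measure_lt_top _ _⟩
  have : IsFiniteMeasure (ν.comap ((↑) : K → ℂ)) :=
    ⟨by rw [(MeasurableEmbedding.subtype_coe hKm).comap_apply]; exact measure_lt_top _ _⟩
  let X : BoundedContinuousFunction K ℂ :=
    BoundedContinuousFunction.mkOfCompact ⟨((↑) : K → ℂ), continuous_subtype_val⟩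
  have hcomap : μ.comap ((↑) : K → ℂ) = ν.comap ((↑) : K → ℂ) := by
    refine ext_of_forall_mem_subalgebra_integral_eq_of_polish (𝕜 := ℂ)
      (A := StarAlgebra.adjoin ℂ {X}) ?_ ?_
    · intro x y hxy
      refine ⟨X, ⟨_, ⟨X, StarAlgebra.subset_adjoin ℂ _ rfl, rfl⟩, rfl⟩, ?_⟩
      exact fun h => hxy (Subtype.ext h)
    · intro g hg
      rw [← StarSubalgebra.mem_toSubalgebra, StarAlgebra.adjoin_toSubalgebra,
        ← Subalgebra.mem_toSubmodule, Algebra.adjoin_eq_span] at hg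
      have hset : ({X} ∪ star {X} : Set (BoundedContinuousFunction K ℂ)) = {star X, X} := by
        rw [Set.star_singleton, Set.union_comm]; rfl
      rw [hset] at hg
      have hI : ∀ (ρ : Measure K) [IsFiniteMeasure ρ] (g : BoundedContinuousFunction K ℂ),
          Integrable (fun x => g x) ρ := fun ρ _ g => g.integrable ρ
      induction hg using Submodule.span_induction with
      | mem g hg =>
        obtain ⟨n, m, rfl⟩ := (Submonoid.mem_closure_pair _ _ _).1 hg
        have e : ∀ x : K, (star X ^ n * X ^ m) x =
            (fun z : ℂ => star (z ^ n) * z ^ m) (x : ℂ) := fun x => by simp [X]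
        have e2 : ∀ ρ : Measure ℂ, ∫ x, (star X ^ n * X ^ m) x ∂(ρ.comap ((↑) : K → ℂ)) =
            ∫ z in K, star (z ^ n) * z ^ m ∂ρ := fun ρ =>
          (integral_congr_ae (Eventually.of_forall e)).trans (integral_subtype_comap hKm fun z : ℂ => star (z ^ n) * z ^ m)
        exact (e2 μ).trans ((hμ.moment n m).trans ((hν.moment n m).symm.trans (e2 ν).symm))
      | zero => simp
      | add g₁ g₂ _ _ h₁ h₂ =>
        simp only [BoundedContinuousFunction.coe_add, Pi.add_apply]
        rw [integral_add (hI _ _) (hI _ _), integral_add (hI _ _) (hI _ _), h₁, h₂]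
      | smul c g _ h =>
        simp only [BoundedContinuousFunction.coe_smul]
        rw [integral_smul, integral_smul, h]
  have h1 := congrArg (Measure.map ((↑) : K → ℂ)) hcomap
  rw [map_comap_subtype_coe hKm, map_comap_subtype_coe hKm,
    Measure.restrict_eq_self_of_ae_mem, Measure.restrict_eq_self_of_ae_mem] at h1
  · exact h1
  · exact hν.compl_disk
  · exact hμ.compl_disk

end Moments

/-! ### Existence of spectral measures -/

section Existence

variable {H : Type*} [NormedAddCommGroup H] [InnerProductSpace ℂ H] [CompleteSpace H]
  {T : H →L[ℂ] H}

/-- The complexification of a real function on a compact space. -/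
def complexify {X : Type*} [TopologicalSpace X] (g : C(X, ℝ)) : C(X, ℂ) :=
  ⟨fun x => (g x : ℂ), by fun_prop⟩

/-- For a normal operator, the Riesz–Markov–Kakutani theorem represents the positive functional
`g ↦ ⟪f, g(T) f⟫` of the continuous functional calculus by a measure. -/
lemma exists_isSpectralMeasure_of_isStarNormal [Nontrivial H] (hT : IsStarNormal T)
    (hT1 : ‖T‖ ≤ 1) (f : H) : ∃ μ, IsSpectralMeasure T f μ := by
  let Φ := cfcHom (R := ℂ) hT
  let L : C(spectrum ℂ T, ℂ) → ℂ := fun g => inner ℂ f (Φ g f)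
  have hLadd : ∀ g₁ g₂, L (g₁ + g₂) = L g₁ + L g₂ := fun g₁ g₂ => by
    simp [L]
  have hLsmul : ∀ (c : ℂ) g, L (c • g) = c * L g := fun c g => by
    simp [L]
  have hmul : ∀ g₁ g₂, L (star g₁ * g₂) = inner ℂ (Φ g₁ f) (Φ g₂ f) := fun g₁ g₂ => by
    simp only [L, map_mul, map_star]
    rw [ContinuousLinearMap.star_eq_adjoint, mul_apply_eq_comp,
      ContinuousLinearMap.adjoint_inner_right]
  have hreal : ∀ g : C(spectrum ℂ T, ℝ), ((L (complexify g)).re : ℂ) = L (complexify g) := by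
    intro g
    have hs : star (complexify g) = complexify g := by
      ext x; simp [complexify]
    have h1 : L (complexify g) = star (L (complexify g)) := by
      conv_lhs => rw [← mul_one (complexify g), ← hs, hmul]
      simp [L]
    exact Complex.conj_eq_iff_re.1 h1.symm
  let Λ : CompactlySupportedContinuousMap (spectrum ℂ T) ℝ →ₚ[ℝ] ℝ := PositiveLinearMap.mk₀
    { toFun := fun g => (L (complexify g.toContinuousMap)).re
      map_add' := fun g₁ g₂ => by
        rw [← Complex.add_re, ← hLadd]
        congr 2
        ext x
        simp [complexify]
      map_smul' := fun c g => by
        have e : complexify (c • g).toContinuousMap = (c : ℂ) • complexify g.toContinuousMap := by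
          ext x
          simp [complexify]
        rw [e, hLsmul]
        simp }
    (fun g hg => by
      let s : C(spectrum ℂ T, ℝ) := ⟨fun x => Real.sqrt (g x), by fun_prop⟩
      have e : complexify g.toContinuousMap = star (complexify s) * complexify s := by
        ext x
        have : 0 ≤ g x := hg x
        simp only [complexify, s, ContinuousMap.coe_mk, ContinuousMap.mul_apply,
          ContinuousMap.star_apply, RCLike.star_def, Complex.conj_ofReal, ← Complex.ofReal_mul,
          Real.mul_self_sqrt this]
        rfl
      change 0 ≤ (L (complexify g.toContinuousMap)).re
      rw [e, hmul]
      exact inner_self_nonneg (𝕜 := ℂ))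
  let ν := RealRMK.rieszMeasure Λ
  have hν : ∀ g : C(spectrum ℂ T, ℝ), ∫ x, (g x : ℂ) ∂ν = L (complexify g) := by
    intro g
    have h1 := RealRMK.integral_rieszMeasure Λ
      (CompactlySupportedContinuousMap.continuousMapEquiv g)
    rw [integral_complex_ofReal, ← hreal g]
    exact congrArg _ h1
  have hνc : ∀ g : C(spectrum ℂ T, ℂ), ∫ x, g x ∂ν = L g := by
    intro g
    let gr : C(spectrum ℂ T, ℝ) := ⟨fun x => (g x).re, by fun_prop⟩
    let gi : C(spectrum ℂ T, ℝ) := ⟨fun x => (g x).im, by fun_prop⟩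
    have e : g = complexify gr + Complex.I • complexify gi := by
      ext x
      simp [complexify, gr, gi, mul_comm Complex.I, Complex.re_add_im]
    have hi : ∀ g : C(spectrum ℂ T, ℝ), Integrable (fun x => (g x : ℂ)) ν := fun g =>
      (complexify g).continuous.integrable_of_hasCompactSupport
        (HasCompactSupport.of_compactSpace _)
    calc ∫ x, g x ∂ν = ∫ x, ((gr x : ℂ) + Complex.I * (gi x : ℂ)) ∂ν := by
          congr 1
          ext x
          conv_lhs => rw [e]
          rfl
      _ = L (complexify gr) + Complex.I * L (complexify gi) := by
          rw [integral_add (hi gr) ((hi gi).const_mul _), integral_const_mul, hν, hν]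
      _ = L g := by rw [← hLsmul, ← hLadd, ← e]
  refine ⟨ν.map Subtype.val, isSpectralMeasure_map ν continuous_subtype_val (fun x => ?_)
    fun n m => ?_⟩
  · have := spectrum.subset_closedBall_norm T x.2
    rw [mem_closedBall_zero_iff] at this
    exact this.trans hT1
  · let I : C(spectrum ℂ T, ℂ) := ContinuousMap.restrict (spectrum ℂ T) (ContinuousMap.id ℂ)
    have hI : Φ I = T := cfcHom_id hT
    have h1 := hνc (star (I ^ n) * I ^ m)
    rw [hmul, map_pow, map_pow, hI] at h1
    exact h1

lemma integral_fourier (n : ℤ) :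
    ∫ x, fourier n x ∂(@AddCircle.haarAddCircle 1 _) = if n = 0 then 1 else 0 := by
  have h := congrFun (@fourierCoeff_fourier (1 : ℝ) _ n) 0
  rw [fourierCoeff, Pi.single_apply] at h
  simpa only [neg_zero, fourier_zero, one_smul, eq_comm] using h

end Existence

section Isometry

variable {H : Type*} [NormedAddCommGroup H] [InnerProductSpace ℂ H] {T : H →L[ℂ] H}

lemma inner_pow_add_pow_add (hT : Isometry T) (f : H) (k m n : ℕ) :
    inner ℂ ((T ^ (k + m)) f) ((T ^ (k + n)) f) = inner ℂ ((T ^ m) f) ((T ^ n) f) := by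
  let S : H →ₗᵢ[ℂ] H := ⟨T.toLinearMap, fun x => by
    simpa using hT.norm_map_of_map_zero (map_zero T) x⟩
  have hS : ∀ x y, inner ℂ (T x) (T y) = inner ℂ x y := fun x y => S.inner_map_map x y
  induction k with
  | zero => simp
  | succ k ih =>
    rw [add_right_comm k 1 m, add_right_comm k 1 n, pow_succ', pow_succ',
      mul_apply_eq_comp, mul_apply_eq_comp, hS, ih]

/-- `∑_{k ≤ N} z^{-k} T ^ k f` at the point `z` of the circle with argument `2πx`; its squared norm,
divided by `N + 1`, is the Fejér mean of the moment sequence of `f`. -/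
noncomputable def fejerVector (T : H →L[ℂ] H) (f : H) (N : ℕ) (x : AddCircle (1 : ℝ)) : H :=
  ∑ k ∈ Finset.range (N + 1), fourier (-(k : ℤ)) x • (T ^ k) f

lemma continuous_fejerVector (f : H) (N : ℕ) : Continuous (fejerVector T f N) := by
  unfold fejerVector
  fun_prop

lemma integral_fejerVector (hT : Isometry T) (f : H) (N d : ℕ) :
    ∫ x, ((‖fejerVector T f N x‖ ^ 2 : ℝ) : ℂ) * fourier (d : ℤ) x ∂AddCircle.haarAddCircle =
      ((N + 1 - d : ℕ) : ℂ) * inner ℂ f ((T ^ d) f) := by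
  have e : ∀ x, ((‖fejerVector T f N x‖ ^ 2 : ℝ) : ℂ) * fourier (d : ℤ) x =
      ∑ k ∈ Finset.range (N + 1), ∑ l ∈ Finset.range (N + 1),
        fourier ((k : ℤ) - l + d) x * inner ℂ ((T ^ k) f) ((T ^ l) f) := by
    intro x
    have h1 : ((‖fejerVector T f N x‖ ^ 2 : ℝ) : ℂ) =
        inner ℂ (fejerVector T f N x) (fejerVector T f N x) := by
      rw [Complex.ofReal_pow]
      exact (inner_self_eq_norm_sq_to_K (𝕜 := ℂ) (fejerVector T f N x)).symm
    rw [h1, fejerVector, sum_inner, Finset.sum_mul]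
    refine Finset.sum_congr rfl fun k _ => ?_
    rw [inner_sum, Finset.sum_mul]
    refine Finset.sum_congr rfl fun l _ => ?_
    rw [inner_smul_left, inner_smul_right, fourier_add, sub_eq_add_neg, fourier_add, fourier_neg,
      fourier_neg, Complex.conj_conj]
    ring
  have hint : ∀ k l : ℕ, Integrable (fun x : AddCircle (1 : ℝ) =>
      fourier ((k : ℤ) - l + d) x * inner ℂ ((T ^ k) f) ((T ^ l) f)) AddCircle.haarAddCircle :=
    fun k l => (by fun_prop : Continuous _).integrable_of_hasCompactSupport
      (HasCompactSupport.of_compactSpace _)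
  simp only [e]
  rw [integral_finsetSum _ fun k _ => integrable_finsetSum _ fun l _ => hint k l]
  have h2 : ∀ k ∈ Finset.range (N + 1),
      ∫ x, ∑ l ∈ Finset.range (N + 1), fourier ((k : ℤ) - l + d) x *
        inner ℂ ((T ^ k) f) ((T ^ l) f) ∂(@AddCircle.haarAddCircle 1 _) =
      if k < N + 1 - d then inner ℂ f ((T ^ d) f) else 0 := by
    intro k _
    rw [integral_finsetSum _ fun l _ => hint k l]
    simp only [integral_mul_const, integral_fourier]
    have h3 : ∀ l : ℕ, ((if (k : ℤ) - l + d = 0 then (1 : ℂ) else 0) *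
        inner ℂ ((T ^ k) f) ((T ^ l) f)) =
        if l = k + d then inner ℂ f ((T ^ d) f) else 0 := by
      intro l
      by_cases hl : l = k + d
      · subst hl
        have := inner_pow_add_pow_add hT f k 0 d
        rw [if_pos (by push_cast; ring), if_pos rfl, one_mul]
        simpa using this
      · rw [if_neg (by omega), if_neg hl, zero_mul]
    simp only [h3, Finset.sum_ite_eq', Finset.mem_range]
    congr 1
    apply propext
    omega
  rw [Finset.sum_congr rfl h2, ← Finset.sum_filter, Finset.sum_const, nsmul_eq_mul]
  congr 2
  have : (Finset.range (N + 1)).filter (fun k => k < N + 1 - d) = Finset.range (N + 1 - d) := by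
    ext k
    simp only [Finset.mem_filter, Finset.mem_range]
    omega
  rw [this, Finset.card_range]

/-- For an isometry, Herglotz' theorem: a limit point of the measures with the Fejér means as
densities is a spectral measure on the circle. -/
lemma exists_isSpectralMeasure_of_isometry (hT : Isometry T) (f : H) :
    ∃ μ, IsSpectralMeasure T f μ := by
  rcases eq_or_ne f 0 with rfl | hf
  · exact ⟨0, inferInstance, by simp, by simp⟩
  have hf0 : 0 < ‖f‖ := norm_pos_iff.2 hf
  let D : ℕ → AddCircle (1 : ℝ) → ℝ := fun N x =>
    ((N + 1 : ℝ) * ‖f‖ ^ 2)⁻¹ * ‖fejerVector T f N x‖ ^ 2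
  have hD0 : ∀ N x, 0 ≤ D N x := fun N x => by positivity
  have hDc : ∀ N, Continuous (D N) := fun N => by
    have := continuous_fejerVector (T := T) f N
    fun_prop
  let ρ : ℕ → Measure (AddCircle (1 : ℝ)) := fun N =>
    AddCircle.haarAddCircle.withDensity fun x => ENNReal.ofReal (D N x)
  have hρ : ∀ (N : ℕ) (d : ℕ), ∫ x, fourier (d : ℤ) x ∂(ρ N) =
      ((N + 1 - d : ℕ) : ℂ) / (N + 1) * (inner ℂ f ((T ^ d) f) / ‖f‖ ^ 2) := by
    intro N d
    rw [integral_withDensity_eq_integral_toReal_smul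
      (hDc N).measurable.ennreal_ofReal
      (Eventually.of_forall fun _ => ENNReal.ofReal_lt_top)]
    have e : ∀ x, (ENNReal.ofReal (D N x)).toReal • fourier (d : ℤ) x =
        (((N + 1 : ℝ) * ‖f‖ ^ 2)⁻¹ : ℝ) *
          (((‖fejerVector T f N x‖ ^ 2 : ℝ) : ℂ) * fourier (d : ℤ) x) := fun x => by
      rw [ENNReal.toReal_ofReal (hD0 N x), Complex.real_smul]
      simp only [D]
      push_cast
      ring
    simp only [e]
    rw [integral_const_mul, integral_fejerVector hT]
    have h1 : (N + 1 : ℂ) ≠ 0 := by exact_mod_cast N.succ_ne_zero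
    have h2 : (‖f‖ : ℂ) ≠ 0 := by exact_mod_cast hf0.ne'
    push_cast
    field_simp
  have hprob : ∀ N, IsProbabilityMeasure (ρ N) := by
    intro N
    have hfin : IsFiniteMeasure (ρ N) :=
      isFiniteMeasure_withDensity_ofReal ((hDc N).integrable_of_hasCompactSupport
        (HasCompactSupport.of_compactSpace _)).2
    have h1 := hρ N 0
    have h2 : inner ℂ f ((T ^ 0) f) = (‖f‖ : ℂ) ^ 2 := by
      simp
    have h3 : (N + 1 : ℂ) ≠ 0 := by exact_mod_cast N.succ_ne_zero
    have h4 : (‖f‖ : ℂ) ≠ 0 := by exact_mod_cast hf0.ne'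
    rw [h2, div_self (pow_ne_zero 2 h4)] at h1
    simp only [Nat.cast_zero, fourier_zero, Nat.sub_zero, mul_one] at h1
    push_cast at h1
    rw [div_self h3, integral_const, Complex.real_smul, mul_one] at h1
    have h5 : (ρ N).real Set.univ = 1 := by exact_mod_cast h1
    exact ⟨by rwa [measureReal_def, ENNReal.toReal_eq_one_iff] at h5⟩
  let P : ℕ → ProbabilityMeasure (AddCircle (1 : ℝ)) := fun N => ⟨ρ N, hprob N⟩
  obtain ⟨Q, -, hQ⟩ := isCompact_univ.ultrafilter_le_nhds
    ((hyperfilter ℕ).map P) (by simp)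
  have hPQ : Tendsto P (hyperfilter ℕ) (𝓝 Q) := hQ
  have hmom : ∀ d : ℕ, ∫ x, fourier (d : ℤ) x ∂(Q : Measure (AddCircle (1 : ℝ))) =
      inner ℂ f ((T ^ d) f) / ‖f‖ ^ 2 := by
    intro d
    have h1 := (ProbabilityMeasure.tendsto_iff_forall_integral_rclike_tendsto ℂ).1 hPQ
      (BoundedContinuousFunction.mkOfCompact (fourier (d : ℤ)))
    refine tendsto_nhds_unique h1 ?_
    have h2 : Tendsto (fun N : ℕ => ((N + 1 - d : ℕ) : ℂ) / (N + 1)) atTop (𝓝 1) := by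
      have h3 : Tendsto (fun N : ℕ => 1 - (d : ℝ) * (1 / ((N : ℝ) + 1))) atTop (𝓝 1) := by
        simpa using (tendsto_one_div_add_atTop_nhds_zero_nat.const_mul (d : ℝ)).const_sub 1
      have h4 := (Complex.continuous_ofReal.tendsto _).comp h3
      rw [Complex.ofReal_one] at h4
      refine h4.congr' ?_
      filter_upwards [eventually_ge_atTop d] with N hN
      have h1 : (N + 1 : ℂ) ≠ 0 := by exact_mod_cast N.succ_ne_zero
      simp only [Function.comp_apply]
      rw [Nat.cast_sub (by omega)]
      push_cast
      field_simp
    have h3 := (h2.mul_const (inner ℂ f ((T ^ d) f) / (‖f‖ : ℂ) ^ 2)).mono_left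
      (Nat.hyperfilter_le_atTop)
    rw [one_mul] at h3
    refine h3.congr fun N => ?_
    exact (hρ N d).symm
  have hpow : ∀ (x : AddCircle (1 : ℝ)) (n : ℕ), fourier 1 x ^ n = fourier (n : ℤ) x := by
    intro x n
    induction n with
    | zero => simp
    | succ n ih => rw [pow_succ, ih, ← fourier_add]; push_cast; rfl
  have hfin : IsFiniteMeasure (ENNReal.ofReal (‖f‖ ^ 2) • (Q : Measure (AddCircle (1 : ℝ)))) :=
    Measure.smul_finite _ ENNReal.ofReal_ne_top
  have hle : ∀ n d : ℕ, ∫ x, star (fourier 1 x ^ n) * fourier 1 x ^ (n + d)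
      ∂(ENNReal.ofReal (‖f‖ ^ 2) • (Q : Measure (AddCircle (1 : ℝ)))) =
      inner ℂ ((T ^ n) f) ((T ^ (n + d)) f) := by
    intro n d
    have e : ∀ x : AddCircle (1 : ℝ),
        star (fourier 1 x ^ n) * fourier 1 x ^ (n + d) = fourier (d : ℤ) x := by
      intro x
      rw [hpow, hpow, ← starRingEnd_apply, ← fourier_neg, ← fourier_add,
        show -(n : ℤ) + ((n + d : ℕ) : ℤ) = d by push_cast; ring]
    simp only [e]
    have h2 : (‖f‖ : ℂ) ≠ 0 := by exact_mod_cast hf0.ne'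
    rw [integral_smul_measure, hmom, ENNReal.toReal_ofReal (by positivity), Complex.real_smul]
    have h3 := inner_pow_add_pow_add hT f n 0 d
    rw [add_zero] at h3
    rw [h3]
    rw [pow_zero, one_apply_eq_self]
    push_cast
    field_simp
  refine ⟨_, isSpectralMeasure_map
    (ENNReal.ofReal (‖f‖ ^ 2) • (Q : Measure (AddCircle (1 : ℝ))))
    (φ := fun x => fourier 1 x) (by fun_prop) (fun x => ?_) fun n m => ?_⟩
  · simp only [fourier_one]
    exact (Circle.norm_coe _).le
  · rcases le_total n m with h | h
    · obtain ⟨d, rfl⟩ := Nat.exists_eq_add_of_le h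
      exact hle n d
    · obtain ⟨d, rfl⟩ := Nat.exists_eq_add_of_le h
      have h1 := congrArg (starRingEnd ℂ) (hle m d)
      rw [← integral_conj, inner_conj_symm] at h1
      rw [← h1]
      congr 1
      ext x
      simp [mul_comm]

end Isometry

/-! ### The equivalence of the three conditions -/

section Criterion

variable {H : Type*} [NormedAddCommGroup H] [InnerProductSpace ℂ H] {T : H →L[ℂ] H} {f : H}
  {b : ℝ → ℝ} {V : ℝ} {μ : Measure ℂ}

/-- The isometry between polynomials in `L²(μ)` and the orbit of `f`, for extended nonnegative
integrals. -/
lemma IsSpectralMeasure.ofReal_norm_sq (hμ : IsSpectralMeasure T f μ) (N : ℕ) (a : ℕ → ℂ) :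
    ENNReal.ofReal (‖∑ k ∈ Finset.range N, a k • (T ^ k) f‖ ^ 2) =
      ∫⁻ z in Metric.closedBall (0 : ℂ) 1,
        ENNReal.ofReal (‖∑ k ∈ Finset.range N, a k * z ^ k‖ ^ 2) ∂μ := by
  have := hμ.finite
  cases N with
  | zero => simp
  | succ n =>
    rw [hμ.norm_sq n a, ofReal_integral_eq_lintegral_ofReal
      (integrableOn_closedBall_of_continuous (by fun_prop))
      (Eventually.of_forall fun z => by positivity)]

/-- The partial sums of `∑ α_n T ^ n f`. -/
noncomputable def orbitSum (b : ℝ → ℝ) (T : H →L[ℂ] H) (f : H) (N : ℕ) : H :=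
  ∑ n ∈ Finset.range N, (renewalCoeff b n : ℂ) • (T ^ n) f

lemma IsSpectralMeasure.ofReal_orbitSum (hμ : IsSpectralMeasure T f μ) (N : ℕ) :
    ENNReal.ofReal (‖orbitSum b T f N‖ ^ 2) =
      ∫⁻ z in Metric.closedBall (0 : ℂ) 1, ENNReal.ofReal (‖partialA b N z‖ ^ 2) ∂μ :=
  hμ.ofReal_norm_sq N _

lemma IsSpectralMeasure.ofReal_orbitSum_sub (hμ : IsSpectralMeasure T f μ) (M N : ℕ) :
    ENNReal.ofReal (‖orbitSum b T f M - orbitSum b T f N‖ ^ 2) =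
      ∫⁻ z in Metric.closedBall (0 : ℂ) 1,
        ENNReal.ofReal (‖partialA b M z - partialA b N z‖ ^ 2) ∂μ := by
  have hM : Finset.range M ⊆ Finset.range (max M N) :=
    Finset.range_subset_range.2 (le_max_left _ _)
  have hN : Finset.range N ⊆ Finset.range (max M N) :=
    Finset.range_subset_range.2 (le_max_right _ _)
  have key := hμ.ofReal_norm_sq (max M N) fun k =>
    (if k ∈ Finset.range M then (renewalCoeff b k : ℂ) else 0) -
      (if k ∈ Finset.range N then (renewalCoeff b k : ℂ) else 0)
  simp only [sub_smul, sub_mul, ite_smul, ite_mul, zero_smul, zero_mul, Finset.sum_sub_distrib,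
    Finset.sum_ite_mem, Finset.inter_eq_right.2 hM, Finset.inter_eq_right.2 hN] at key
  exact key

lemma continuous_partialA (b : ℝ → ℝ) (N : ℕ) : Continuous (partialA b N) := by
  unfold partialA
  fun_prop

namespace HalfRegular

/-- If the partial sums converge, they are bounded, and Fatou's lemma bounds `∫ |A|²`. -/
lemma lintegral_normSqA_lt_top (h : HalfRegular b V) (hμ : IsSpectralMeasure T f μ) {g : H}
    (hg : Tendsto (orbitSum b T f) atTop (𝓝 g)) :
    ∫⁻ z in Metric.closedBall (0 : ℂ) 1, normSqA b z ∂μ < ⊤ := by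
  have hlim : Tendsto (fun N => ENNReal.ofReal (‖orbitSum b T f N‖ ^ 2)) atTop
      (𝓝 (ENNReal.ofReal (‖g‖ ^ 2))) := ENNReal.tendsto_ofReal (hg.norm.pow 2)
  have hpt : ∀ z ∈ Metric.closedBall (0 : ℂ) 1, normSqA b z =
      liminf (fun N => ENNReal.ofReal (‖partialA b N z‖ ^ 2)) atTop := by
    intro z hz
    refine (Tendsto.liminf_eq ?_).symm
    rcases eq_or_ne z 1 with rfl | hz1
    · rw [normSqA, if_pos rfl]
      refine ENNReal.tendsto_ofReal_atTop.comp ?_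
      exact (tendsto_pow_atTop two_ne_zero).comp h.tendsto_norm_partialA_one
    · rw [normSqA, if_neg hz1]
      exact ENNReal.tendsto_ofReal ((h.tendsto_partialA (by simpa using hz) hz1).norm.pow 2)
  calc ∫⁻ z in Metric.closedBall (0 : ℂ) 1, normSqA b z ∂μ =
        ∫⁻ z in Metric.closedBall (0 : ℂ) 1,
          liminf (fun N => ENNReal.ofReal (‖partialA b N z‖ ^ 2)) atTop ∂μ :=
        setLIntegral_congr_fun Metric.isClosed_closedBall.measurableSet hpt
    _ ≤ liminf (fun N => ∫⁻ z in Metric.closedBall (0 : ℂ) 1,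
          ENNReal.ofReal (‖partialA b N z‖ ^ 2) ∂μ) atTop :=
        lintegral_liminf_le fun N => by
          have := (continuous_partialA b N).measurable
          fun_prop
    _ = liminf (fun N => ENNReal.ofReal (‖orbitSum b T f N‖ ^ 2)) atTop := by
        simp only [hμ.ofReal_orbitSum]
    _ = ENNReal.ofReal (‖g‖ ^ 2) := hlim.liminf_eq
    _ < ⊤ := ENNReal.ofReal_lt_top

/-- If `∫ |A|²` is finite, dominated convergence makes the partial sums a Cauchy sequence. -/
lemma exists_tendsto_orbitSum [CompleteSpace H] (h : HalfRegular b V)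
    (hμ : IsSpectralMeasure T f μ)
    (hA : ∫⁻ z in Metric.closedBall (0 : ℂ) 1, normSqA b z ∂μ < ⊤) :
    ∃ g, Tendsto (orbitSum b T f) atTop (𝓝 g) := by
  have hKm : MeasurableSet (Metric.closedBall (0 : ℂ) 1) :=
    Metric.isClosed_closedBall.measurableSet
  -- The integrand is infinite at `1`, so `1` is not an atom of `μ`.
  have hone : ∀ᵐ z ∂(μ.restrict (Metric.closedBall (0 : ℂ) 1)), z ≠ 1 := by
    rw [ae_iff]
    simp only [ne_eq, not_not, Set.ofPred_eq_eq_singleton]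
    by_contra hne
    refine hA.ne (top_le_iff.1 ?_)
    calc ⊤ = normSqA b 1 * (μ.restrict (Metric.closedBall (0 : ℂ) 1)) {1} := by
          rw [normSqA, if_pos rfl, ENNReal.top_mul hne]
      _ = ∫⁻ z in {1}, normSqA b z ∂(μ.restrict (Metric.closedBall (0 : ℂ) 1)) := by
          rw [lintegral_singleton]
      _ ≤ _ := setLIntegral_le_lintegral _ _
  have hball : ∀ᵐ z ∂(μ.restrict (Metric.closedBall (0 : ℂ) 1)), ‖z‖ ≤ 1 :=
    (ae_restrict_mem hKm).mono fun z hz => by simpa using hz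
  have hlim : Tendsto (fun p : ℕ × ℕ => ∫⁻ z in Metric.closedBall (0 : ℂ) 1,
      ENNReal.ofReal (‖partialA b p.1 z - partialA b p.2 z‖ ^ 2) ∂μ) atTop (𝓝 0) := by
    have hdom := tendsto_lintegral_filter_of_dominated_convergence
      (μ := μ.restrict (Metric.closedBall (0 : ℂ) 1)) (l := (atTop : Filter (ℕ × ℕ)))
      (F := fun p z => ENNReal.ofReal (‖partialA b p.1 z - partialA b p.2 z‖ ^ 2))
      (f := fun _ => 0) (fun z => ENNReal.ofReal 16 * normSqA b z) ?_ ?_ ?_ ?_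
    · simpa using hdom
    · refine Eventually.of_forall fun p => ?_
      have h1 := (continuous_partialA b p.1).measurable
      have h2 := (continuous_partialA b p.2).measurable
      fun_prop
    · refine Eventually.of_forall fun p => ?_
      filter_upwards [hone, hball] with z hz1 hz
      rw [normSqA, if_neg hz1, ← ENNReal.ofReal_mul (by norm_num)]
      refine ENNReal.ofReal_le_ofReal ?_
      have h1 := h.norm_partialA_le hz hz1 p.1
      have h2 := h.norm_partialA_le hz hz1 p.2
      have h3 : ‖partialA b p.1 z - partialA b p.2 z‖ ≤ 4 * ‖funA b z‖ :=
        (norm_sub_le _ _).trans (by linarith)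
      calc _ ≤ (4 * ‖funA b z‖) ^ 2 := pow_le_pow_left₀ (norm_nonneg _) h3 2
        _ = _ := by ring
    · rw [lintegral_const_mul' _ _ ENNReal.ofReal_ne_top]
      exact (ENNReal.mul_lt_top ENNReal.ofReal_lt_top hA).ne
    · filter_upwards [hone, hball] with z hz1 hz
      have h1 := h.tendsto_partialA hz hz1
      rw [← prod_atTop_atTop_eq]
      have h2 := (((h1.comp tendsto_fst).sub (h1.comp tendsto_snd)).norm.pow 2 :
        Tendsto _ (atTop ×ˢ atTop) _)
      simpa using ENNReal.tendsto_ofReal h2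
  simp only [← hμ.ofReal_orbitSum_sub] at hlim
  refine cauchySeq_tendsto_of_complete ?_
  rw [cauchySeq_iff_tendsto_dist_atTop_0]
  have h1 := (ENNReal.tendsto_toReal ENNReal.zero_ne_top).comp hlim
  have h2 := (Real.continuous_sqrt.tendsto _).comp h1
  simp only [ENNReal.toReal_zero, Real.sqrt_zero] at h2
  refine h2.congr fun p => ?_
  simp only [Function.comp_apply]
  rw [ENNReal.toReal_ofReal (by positivity), Real.sqrt_sq (norm_nonneg _), dist_eq_norm]

/-- The weighted series of `‖U_n f‖²` expressed through the spectral measure, by Tonelli's theorem. -/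
lemma summable_iff_lintegral_powerWeight_lt_top (h : HalfRegular b V)
    (hμ : IsSpectralMeasure T f μ) :
    (Summable fun n : ℕ => b ((n + 1 : ℕ) : ℝ) * ‖powerSum T (n + 1) f‖ ^ 2 /
      ((n + 1 : ℕ) : ℝ) ^ 2) ↔
      ∫⁻ z in Metric.closedBall (0 : ℂ) 1, powerWeight b z ∂μ < ⊤ := by
  have hpos : ∀ n : ℕ, 0 < b ((n + 1 : ℕ) : ℝ) := fun n => h.pos _ (by
    push_cast; linarith [n.cast_nonneg (α := ℝ)])
  have hU : ∀ n : ℕ, ENNReal.ofReal (‖powerSum T n f‖ ^ 2) =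
      ∫⁻ z in Metric.closedBall (0 : ℂ) 1,
        ENNReal.ofReal (‖∑ k ∈ Finset.Icc 1 n, z ^ k‖ ^ 2) ∂μ := by
    intro n
    have hsub : Finset.range (n + 1) ∩ Finset.Icc 1 n = Finset.Icc 1 n := by
      rw [Finset.inter_eq_right]
      intro k hk
      have := Finset.mem_Icc.1 hk
      exact Finset.mem_range.2 (by omega)
    have key := hμ.ofReal_norm_sq (n + 1) fun k => if k ∈ Finset.Icc 1 n then 1 else 0
    simp only [ite_smul, ite_mul, zero_smul, zero_mul, one_smul, one_mul, Finset.sum_ite_mem,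
      hsub] at key
    exact key
  have hterm : ∀ n : ℕ, ENNReal.ofReal (b ((n + 1 : ℕ) : ℝ) * ‖powerSum T (n + 1) f‖ ^ 2 /
      ((n + 1 : ℕ) : ℝ) ^ 2) = ∫⁻ z in Metric.closedBall (0 : ℂ) 1,
        ENNReal.ofReal (b ((n + 1 : ℕ) : ℝ) * ‖∑ k ∈ Finset.Icc 1 (n + 1), z ^ k‖ ^ 2 /
          ((n + 1 : ℕ) : ℝ) ^ 2) ∂μ := by
    intro n
    have hc : 0 ≤ b ((n + 1 : ℕ) : ℝ) / ((n + 1 : ℕ) : ℝ) ^ 2 :=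
      div_nonneg (hpos n).le (sq_nonneg _)
    simp only [mul_div_right_comm, ENNReal.ofReal_mul hc]
    rw [hU, lintegral_const_mul' _ _ ENNReal.ofReal_ne_top]
  have hW : ∫⁻ z in Metric.closedBall (0 : ℂ) 1, powerWeight b z ∂μ =
      ∑' n : ℕ, ENNReal.ofReal (b ((n + 1 : ℕ) : ℝ) * ‖powerSum T (n + 1) f‖ ^ 2 /
        ((n + 1 : ℕ) : ℝ) ^ 2) := by
    simp only [hterm, powerWeight]
    exact lintegral_tsum fun n => Measurable.aemeasurable (by fun_prop)
  have hnn : ∀ n : ℕ, 0 ≤ b ((n + 1 : ℕ) : ℝ) * ‖powerSum T (n + 1) f‖ ^ 2 /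
      ((n + 1 : ℕ) : ℝ) ^ 2 := fun n => by
    have := hpos n
    positivity
  rw [hW]
  refine ⟨fun hs => ?_, fun hs => ?_⟩
  · rw [← ENNReal.ofReal_tsum_of_nonneg hnn hs]
    exact ENNReal.ofReal_lt_top
  · simpa only [ENNReal.toReal_ofReal (hnn _)] using ENNReal.summable_toReal hs.ne

end HalfRegular

end Criterion

end SpectralSeries

theorem mainTheorem3
    {H : Type*} [NormedAddCommGroup H] [InnerProductSpace ℂ H] [CompleteSpace H]
    (u₀ : ℝ) (hu₀ : u₀ < 1 / 2) (b : ℝ → ℝ)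
    (hb : SpectralSeries.IsSlowlyVarying u₀ b)
    (hb_meas : Measurable (fun u : Set.Ioi u₀ => b u))
    (hb_bdd : ∀ R : ℝ, BddAbove (b '' Set.Icc (1 / 2) R))
    (T : H →L[ℂ] H) (hT : (IsStarNormal T ∧ ‖T‖ ≤ 1) ∨ Isometry T) (f : H) :
    (∃! μ : Measure ℂ, SpectralSeries.IsSpectralMeasure T f μ) ∧
      ∀ μ : Measure ℂ, SpectralSeries.IsSpectralMeasure T f μ →
        List.TFAE [
          ∃ g : H, Tendsto
            (fun N : ℕ => ∑ n ∈ Finset.range N, SpectralSeries.alphaCoeff b n • (T ^ n) f)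
            atTop (𝓝 g),
          ∫⁻ z in Metric.closedBall (0 : ℂ) 1, SpectralSeries.diskWeight b z ∂μ < ⊤,
          Summable (fun n : ℕ =>
            b ((n + 1 : ℕ) : ℝ) * ‖SpectralSeries.powerSum T (n + 1) f‖ ^ 2 /
              ((n + 1 : ℕ) : ℝ) ^ 2)] := by
  refine ⟨?_, fun μ hμ => ?_⟩
  · have hex : ∃ μ, SpectralSeries.IsSpectralMeasure T f μ := by
      rcases subsingleton_or_nontrivial H with hH | hH
      · exact SpectralSeries.exists_isSpectralMeasure_of_isometry
          (isometry_subsingleton : Isometry T) f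
      · rcases hT with ⟨hT, hT1⟩ | hT
        · exact SpectralSeries.exists_isSpectralMeasure_of_isStarNormal hT hT1 f
        · exact SpectralSeries.exists_isSpectralMeasure_of_isometry hT f
    obtain ⟨μ, hμ⟩ := hex
    exact ⟨μ, hμ, fun ν hν => hν.unique hμ⟩
  · obtain ⟨V, h⟩ := hb.exists_halfRegular hu₀
    have := hμ.finite
    have hα : (fun N : ℕ => ∑ n ∈ Finset.range N, SpectralSeries.alphaCoeff b n • (T ^ n) f) =
        SpectralSeries.orbitSum b T f := by
      ext N
      simp only [h.alphaCoeff_eq]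
      rfl
    rw [hα]
    tfae_have 1 → 2 := fun ⟨g, hg⟩ =>
      (h.diskWeight_dominated_normSqA (hb_bdd V)).lintegral_lt_top
        (h.lintegral_normSqA_lt_top hμ hg)
    tfae_have 2 → 1 := fun h2 =>
      h.exists_tendsto_orbitSum hμ (h.normSqA_dominated_diskWeight.lintegral_lt_top h2)
    tfae_have 2 → 3 := fun h2 => (h.summable_iff_lintegral_powerWeight_lt_top hμ).2
      (h.powerWeight_dominated_diskWeight.lintegral_lt_top h2)
    tfae_have 3 → 2 := fun h3 => (h.diskWeight_dominated_powerWeight hb_bdd).lintegral_lt_top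
      ((h.summable_iff_lintegral_powerWeight_lt_top hμ).1 h3)
    tfae_finish
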